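/- Let $(\mathcal M,g)$ be a smooth two-dimensional Riemannian manifold without boundary (for example a compact, simply connected surface), let $\varepsilon>0$, and let $u=(u_1,u_2):\mathcal M\times(0,\infty)\to\mathbb R^2$ be a classical solution, jointly of class $C^3$ (in particular any smooth solution), of the Ginzburg–Landau heat flow $$u_t-\Delta_{\mathcal M}u=\frac{u}{\varepsilon^2}\,(1-|u|^2)\qquad\text{in }\mathcal M\times(0,\infty),$$ where $\Delta_{\mathcal M}$ is the Laplace–Beltrami operator, acting on each component. Let $$e_\varepsilon(u)=\frac{|\nabla_g u|^2}{2}+\frac{(1-|u|^2)^2}{4\varepsilon^2}$$ be the energy density. Then $e_\varepsilon(u)$ is of class $C^2$ on $\mathcal M\times(0,\infty)$, and at every point of $\mathcal M\times(0,\infty)$ $$[e_\varepsilon(u)]_t-\Delta_{\mathcal M}[e_\varepsilon(u)]=\frac{2}{\varepsilon^2}(1-|u|^2)|\nabla_g u|^2-|\mathrm{Hess}\,u|^2-\frac{4}{\varepsilon^2}|u\cdot\nabla_g u|^2-\frac{1}{\varepsilon^4}(1-|u|^2)^2|u|^2-|\nabla_g u|^2K_{\mathcal M}.$$ Here $|\nabla_g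 u|^2=\sum_k|\nabla_g u_k|_g^2$; $|\mathrm{Hess}\,u|^2=\sum_k|\mathrm{Hess}\,u_k|^2$ with the Hilbert–Schmidt norm of the endomorphism $\mathrm{Hess}\,f(X)=\nabla_X\nabla_g f$, where $\nabla_X$ is the Levi-Civita covariant derivative; $u\cdot\nabla_g u=\sum_k u_k\nabla_g u_k$ is a tangent vector, measured in the metric $g$; and $K_{\mathcal M}$ is the Gaussian curvature. -/

import Mathlib

open scoped Manifold ContDiff

noncomputable section

namespace GLSurface

/-- The Euclidean plane: the model space of a surface, and the space of values of the order
parameter (`ℂ` identified with `ℝ²`). -/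
abbrev Plane : Type := EuclideanSpace ℝ (Fin 2)

/-! ### Riemannian geometry in a coordinate system

Here `G : Plane → Matrix (Fin 2) (Fin 2) ℝ` is the matrix `(g_{ij})` of a metric in coordinates
`(x₀, x₁)`, functions are given by their coordinate expression `f : Plane → ℝ`, and vector fields
by their components `Y : Plane → Fin 2 → ℝ` with respect to the coordinate frame `∂₀, ∂₁`. -/

/-- The partial derivative `∂_i F`. -/
def pd (i : Fin 2) (F : Plane → ℝ) (x : Plane) : ℝ :=
  fderiv ℝ F x (EuclideanSpace.single i 1)

/-- The components of the coordinate vector field `∂_i`. -/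
def coordField (i : Fin 2) : Plane → Fin 2 → ℝ := fun _ => Pi.single i 1

/-- The inner product `⟨v, w⟩_g = ∑ g_{ij} v^i w^j` at the point `x`. -/
def innerC (G : Plane → Matrix (Fin 2) (Fin 2) ℝ) (x : Plane) (v w : Fin 2 → ℝ) : ℝ :=
  ∑ i, ∑ j, G x i j * v i * w j

/-- The gradient, `(∇_g f)^k = ∑ g^{kl} ∂_l f`. -/
def gradC (G : Plane → Matrix (Fin 2) (Fin 2) ℝ) (f : Plane → ℝ) (x : Plane) : Fin 2 → ℝ :=
  fun k => ∑ l, (G x)⁻¹ k l * pd l f x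

/-- The Christoffel symbol `Γ^k_{ij}` of the Levi-Civita connection. -/
def christoffel (G : Plane → Matrix (Fin 2) (Fin 2) ℝ) (k i j : Fin 2) (x : Plane) : ℝ :=
  (1 / 2 : ℝ) * ∑ l, (G x)⁻¹ k l *
    (pd i (fun y => G y j l) x + pd j (fun y => G y i l) x - pd l (fun y => G y i j) x)

/-- The covariant derivative `∇_X Y` of the Levi-Civita connection,
`(∇_X Y)^k = ∑ X^i (∂_i Y^k + ∑ Γ^k_{ij} Y^j)`. -/
def covDeriv (G : Plane → Matrix (Fin 2) (Fin 2) ℝ) (X Y : Plane → Fin 2 → ℝ) (x : Plane) :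
    Fin 2 → ℝ :=
  fun k => ∑ i, X x i * (pd i (fun y => Y y k) x + ∑ j, christoffel G k i j x * Y x j)

/-- The Hessian as an endomorphism, `Hess f (X) = ∇_X ∇_g f`, evaluated on `X = ∂_i`. -/
def hessC (G : Plane → Matrix (Fin 2) (Fin 2) ℝ) (f : Plane → ℝ) (x : Plane) (i : Fin 2) :
    Fin 2 → ℝ :=
  covDeriv G (coordField i) (gradC G f) x

/-- The Laplace-Beltrami operator, `Δ f = div ∇_g f`, the trace of `Hess f`. -/
def laplacianC (G : Plane → Matrix (Fin 2) (Fin 2) ℝ) (f : Plane → ℝ) (x : Plane) : ℝ :=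
  ∑ i, hessC G f x i i

/-- The squared Hilbert-Schmidt norm `|Hess f|² = ∑ g^{ij} ⟨Hess f (∂_i), Hess f (∂_j)⟩_g`. -/
def hessNormSqC (G : Plane → Matrix (Fin 2) (Fin 2) ℝ) (f : Plane → ℝ) (x : Plane) : ℝ :=
  ∑ i, ∑ j, (G x)⁻¹ i j * innerC G x (hessC G f x i) (hessC G f x j)

/-- The curvature `R(∂_i, ∂_j) ∂_k = ∇_{∂_i} ∇_{∂_j} ∂_k - ∇_{∂_j} ∇_{∂_i} ∂_k`
(coordinate vector fields commute). -/
def curvC (G : Plane → Matrix (Fin 2) (Fin 2) ℝ) (i j k : Fin 2) (x : Plane) : Fin 2 → ℝ :=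
  covDeriv G (coordField i) (covDeriv G (coordField j) (coordField k)) x -
    covDeriv G (coordField j) (covDeriv G (coordField i) (coordField k)) x

/-- The Gaussian curvature `K = ⟨R(∂₀, ∂₁) ∂₁, ∂₀⟩_g / (g₀₀ g₁₁ - g₀₁²)`. -/
def gaussC (G : Plane → Matrix (Fin 2) (Fin 2) ℝ) (x : Plane) : ℝ :=
  innerC G x (curvC G 0 1 1 x) (coordField 0 x) / (G x).det

/-! ### A surface with a smooth Riemannian metric

The value at `p` of each geometric quantity is computed in the coordinate system
`extChartAt (𝓡 2) p` around `p`. -/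

section Surface

variable {M : Type*} [TopologicalSpace M] [ChartedSpace (EuclideanSpace ℝ (Fin 2)) M]
  [IsManifold (𝓡 2) ∞ M]

/-- The type of smooth Riemannian metrics on the surface `M`. -/
abbrev SurfaceMetric (M : Type*) [TopologicalSpace M]
    [ChartedSpace (EuclideanSpace ℝ (Fin 2)) M] [IsManifold (𝓡 2) ∞ M] : Type _ :=
  Bundle.ContMDiffRiemannianMetric (𝓡 2) ∞ (EuclideanSpace ℝ (Fin 2))
    (TangentSpace (𝓡 2) : M → Type)

/-- The matrix `g_{ij} = g(∂_i, ∂_j)` of the metric in the coordinates around `p`. -/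
def metricMatrix (g : SurfaceMetric M) (p : M) (x : Plane) : Matrix (Fin 2) (Fin 2) ℝ :=
  Matrix.of fun i j =>
    g.inner ((extChartAt (𝓡 2) p).symm x)
      (mfderiv 𝓘(ℝ, Plane) (𝓡 2) (extChartAt (𝓡 2) p).symm x (EuclideanSpace.single i (1 : ℝ)))
      (mfderiv 𝓘(ℝ, Plane) (𝓡 2) (extChartAt (𝓡 2) p).symm x (EuclideanSpace.single j (1 : ℝ)))

/-- The coordinate expression of a function in the coordinates around `p`. -/
def coordExpr (p : M) (f : M → ℝ) : Plane → ℝ := fun x => f ((extChartAt (𝓡 2) p).symm x)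

/-- The gradient `∇_g f` at `p`, by its components in the coordinate frame at `p`. -/
def grad (g : SurfaceMetric M) (f : M → ℝ) (p : M) : Fin 2 → ℝ :=
  gradC (metricMatrix g p) (coordExpr p f) (extChartAt (𝓡 2) p p)

/-- `|v|_g²` for a tangent vector at `p` with components `v` in the coordinate frame at `p`. -/
def normSq (g : SurfaceMetric M) (p : M) (v : Fin 2 → ℝ) : ℝ :=
  innerC (metricMatrix g p) (extChartAt (𝓡 2) p p) v v

/-- The Laplace-Beltrami operator on functions. -/
def laplaceBeltrami (g : SurfaceMetric M) (f : M → ℝ) (p : M) : ℝ :=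
  laplacianC (metricMatrix g p) (coordExpr p f) (extChartAt (𝓡 2) p p)

/-- The Gaussian curvature `K_M` of the surface. -/
def gaussCurvature (g : SurfaceMetric M) (p : M) : ℝ :=
  gaussC (metricMatrix g p) (extChartAt (𝓡 2) p p)

/-- `Δ u = (Δ u₁, Δ u₂)` for a map to the plane. -/
def laplaceBeltramiVec (g : SurfaceMetric M) (u : M → Plane) (p : M) : Plane :=
  WithLp.toLp 2 fun k => laplaceBeltrami g (fun q => u q k) p

/-- `|∇_g u|² = |∇_g u₁|² + |∇_g u₂|²`. -/
def gradNormSq (g : SurfaceMetric M) (u : M → Plane) (p : M) : ℝ :=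
  ∑ k, normSq g p (grad g (fun q => u q k) p)

/-- `|Hess u|² = |Hess u₁|² + |Hess u₂|²`. -/
def hessNormSq (g : SurfaceMetric M) (u : M → Plane) (p : M) : ℝ :=
  ∑ k, hessNormSqC (metricMatrix g p) (coordExpr p fun q => u q k) (extChartAt (𝓡 2) p p)

/-- The tangent vector `u · ∇_g u = u₁ ∇_g u₁ + u₂ ∇_g u₂`. -/
def dotGrad (g : SurfaceMetric M) (u : M → Plane) (p : M) : Fin 2 → ℝ :=
  ∑ k, u p k • grad g (fun q => u q k) p

/-- The Ginzburg-Landau energy density `e_ε(u) = |∇_g u|²/2 + (1 - |u|²)²/(4 ε²)`. -/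
def energyDensity (g : SurfaceMetric M) (ε : ℝ) (u : M → Plane) (p : M) : ℝ :=
  gradNormSq g u p / 2 + (1 - ‖u p‖ ^ 2) ^ 2 / (4 * ε ^ 2)

/-- `u` is a classical solution, of class `C³`, of the Ginzburg-Landau heat flow
`u_t - Δ u = (u / ε²) (1 - |u|²)` in `M × (0, ∞)`. -/
structure IsHeatFlow (g : SurfaceMetric M) (ε : ℝ) (u : M → ℝ → Plane) : Prop where
  regular : ContMDiffOn ((𝓡 2).prod 𝓘(ℝ, ℝ)) 𝓘(ℝ, Plane) 3
    (fun q : M × ℝ => u q.1 q.2) {q : M × ℝ | 0 < q.2}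
  equation : ∀ (p : M) (t : ℝ), 0 < t →
    deriv (fun s => u p s) t - laplaceBeltramiVec g (fun q => u q t) p =
      ((1 - ‖u p t‖ ^ 2) / ε ^ 2) • u p t

end Surface

end GLSurface

end

/-!
The identity is local, so it is proved in a single coordinate system, the chart at a fixed point
`p`, by Bochner's formula.

In coordinates, all covariant objects are written with the inverse metric, the Christoffel symbols
and the covariant Hessian `F_{ij} = ∂_i ∂_j f - ∑ Γ^m_{ij} ∂_m f` (`covHess`). Metric compatibility
(`IsMetricOn.pd_metric`, `IsMetricOn.pd_inv`) makes differentiation of the index raising operators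
covariant, so that each identity becomes polynomial in the components. The only curvature input
is that, on a surface, the curvature operator with one index raised is `K ε^{mn}`
(`IsMetricOn.curvC_raise`), which comes from the symmetry of the second derivatives of the inverse
metric. With the Ricci identity this gives Bochner's formula
`Δ |∇f|² = 2 (|Hess f|² + ⟨∇f, ∇Δf⟩ + K |∇f|²)` (`IsMetricOn.laplacianC_gradInner`), and the
evolution of the energy density follows by inserting the equation into `⟨∇u, ∇(u_t - Δu)⟩`
(`IsMetricOn.energyC_evolution`).

The geometric quantities at a point `q` are defined in the chart at `q`, whereas the argument
differentiates the energy density and the equation as functions on a neighbourhood of `p`. Both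
have to be expressed in the chart at `p`, which requires that `⟨∇f, ∇h⟩` and `Δ f` do not depend on
the chart. For the former this is the chain rule (`IsPullbackOn.gradInner_comp`). The latter is
reduced to the former: `2 Hess f (∇h, ∇k)` equals
`⟨∇h, ∇⟨∇f, ∇k⟩⟩ + ⟨∇k, ∇⟨∇f, ∇h⟩⟩ - ⟨∇f, ∇⟨∇h, ∇k⟩⟩`, and the Laplacian is recovered by taking the
coordinate functions for `h` and `k` (`IsPullbackOn.laplacianC_comp`).
-/

noncomputable section

namespace GLSurface

open Filter Topology


/-! ### Calculus of partial derivatives -/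

section Partial

variable {F F' : Plane → ℝ} {x : Plane} {i j : Fin 2}

theorem pd_congr (h : F =ᶠ[𝓝 x] F') : pd i F x = pd i F' x := by
  simp only [pd, h.fderiv_eq]

theorem pd_const (c : ℝ) : pd i (fun _ => c) x = 0 := by simp [pd]

theorem pd_coord (k : Fin 2) : pd i (fun y : Plane => y k) x = if k = i then 1 else 0 := by
  have h : (fun y : Plane => y k) = EuclideanSpace.proj (𝕜 := ℝ) k := rfl
  rw [pd, h, ContinuousLinearMap.fderiv]
  simp

theorem pd_add (hF : DifferentiableAt ℝ F x) (hF' : DifferentiableAt ℝ F' x) :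
    pd i (fun y => F y + F' y) x = pd i F x + pd i F' x := by
  simp only [pd, fderiv_fun_add hF hF', add_apply]

theorem pd_sub (hF : DifferentiableAt ℝ F x) (hF' : DifferentiableAt ℝ F' x) :
    pd i (fun y => F y - F' y) x = pd i F x - pd i F' x := by
  simp only [pd, fderiv_fun_sub hF hF', sub_apply]

theorem pd_mul (hF : DifferentiableAt ℝ F x) (hF' : DifferentiableAt ℝ F' x) :
    pd i (fun y => F y * F' y) x = pd i F x * F' x + F x * pd i F' x := by
  simp only [pd, fderiv_fun_mul hF hF', add_apply, smul_apply, smul_eq_mul]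
  ring

theorem _root_.ContDiffAt.pd {m n : WithTop ℕ∞} (hF : ContDiffAt ℝ n F x) (hmn : m + 1 ≤ n)
    (i : Fin 2) : ContDiffAt ℝ m (pd i F) x :=
  (hF.fderiv_right hmn).clm_apply contDiffAt_const

theorem _root_.ContDiffAt.pd_infty (hF : ContDiffAt ℝ ∞ F x) (i : Fin 2) :
    ContDiffAt ℝ ∞ (GLSurface.pd i F) x :=
  hF.pd le_rfl i

theorem pd_comm (hF : ContDiffAt ℝ 2 F x) (i j : Fin 2) :
    pd i (pd j F) x = pd j (pd i F) x := by
  have hd : DifferentiableAt ℝ (fderiv ℝ F) x :=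
    (hF.fderiv_right (m := 1) le_rfl).differentiableAt one_ne_zero
  have key : ∀ a b : Fin 2, pd a (pd b F) x =
      fderiv ℝ (fderiv ℝ F) x (EuclideanSpace.single a 1) (EuclideanSpace.single b 1) := by
    intro a b
    change fderiv ℝ (fun y => fderiv ℝ F y (EuclideanSpace.single b 1)) x _ = _
    rw [fderiv_clm_apply hd (differentiableAt_const _)]
    simp
  rw [key, key]
  exact (hF.isSymmSndFDerivAt (by simp)).eq _ _

theorem pd_apply {φ : Plane → Plane} (hφ : DifferentiableAt ℝ φ x) (a : Fin 2) :
    pd i (fun y => φ y a) x = (fderiv ℝ φ x (EuclideanSpace.single i 1)) a := by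
  have h := ((EuclideanSpace.proj (𝕜 := ℝ) a : Plane →L[ℝ] ℝ).hasFDerivAt
    (x := φ x)).comp x hφ.hasFDerivAt
  have h' : fderiv ℝ (fun y => φ y a) x = _ := h.fderiv
  rw [pd, h']
  rfl

theorem eq_sum_smul_single (v : Plane) : v = ∑ a, v a • EuclideanSpace.single a (1 : ℝ) := by
  ext b
  fin_cases b <;> simp

/-- The chain rule for partial derivatives. -/
theorem pd_comp {φ : Plane → Plane} (hF : DifferentiableAt ℝ F (φ x))
    (hφ : DifferentiableAt ℝ φ x) :
    pd i (fun y => F (φ y)) x = ∑ a, pd i (fun y => φ y a) x * pd a F (φ x) := by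
  have h2 : fderiv ℝ (fun y => F (φ y)) x = _ := (hF.hasFDerivAt.comp x hφ.hasFDerivAt).fderiv
  rw [pd, h2]
  simp only [pd_apply hφ, ContinuousLinearMap.comp_apply]
  conv_lhs => rw [eq_sum_smul_single (fderiv ℝ φ x (EuclideanSpace.single i 1))]
  simp [pd]

end Partial

/-! ### The Levi-Civita connection in coordinates -/

/-- The matrix field `G` is a smooth (possibly indefinite) metric on the open set `Ω`. -/
structure IsMetricOn (G : Plane → Matrix (Fin 2) (Fin 2) ℝ) (Ω : Set Plane) : Prop where
  isOpen : IsOpen Ω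
  smooth : ∀ i j, ContDiffOn ℝ ∞ (fun y => G y i j) Ω
  symm : ∀ y ∈ Ω, ∀ i j, G y i j = G y j i
  det_ne : ∀ y ∈ Ω, (G y).det ≠ 0

/-- The covariant Hessian `∂_i ∂_j f - ∑ Γ^m_{ij} ∂_m f`, a bilinear form. -/
def covHess (G : Plane → Matrix (Fin 2) (Fin 2) ℝ) (f : Plane → ℝ) (i j : Fin 2) (x : Plane) : ℝ :=
  pd i (pd j f) x - ∑ m, christoffel G m i j x * pd m f x

/-- The inner product of two gradients, `⟨∇f, ∇h⟩_g = ∑ g^{ij} ∂_i f ∂_j h`. -/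
def gradInner (G : Plane → Matrix (Fin 2) (Fin 2) ℝ) (f h : Plane → ℝ) (x : Plane) : ℝ :=
  ∑ i, ∑ j, (G x)⁻¹ i j * pd i f x * pd j h x

namespace IsMetricOn

variable {G : Plane → Matrix (Fin 2) (Fin 2) ℝ} {Ω : Set Plane} {x : Plane} {f h : Plane → ℝ}

theorem mem_nhds (hG : IsMetricOn G Ω) (hx : x ∈ Ω) : Ω ∈ 𝓝 x := hG.isOpen.mem_nhds hx

theorem contDiffAt (hG : IsMetricOn G Ω) (hx : x ∈ Ω) (i j : Fin 2) :
    ContDiffAt ℝ ∞ (fun y => G y i j) x :=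
  (hG.smooth i j).contDiffAt (hG.mem_nhds hx)

theorem contDiffAt_inv (hG : IsMetricOn G Ω) (hx : x ∈ Ω) (i j : Fin 2) :
    ContDiffAt ℝ ∞ (fun y => (G y)⁻¹ i j) x := by
  have hd : ContDiffAt ℝ ∞ (fun y => (G y).det⁻¹) x := by
    refine ContDiffAt.inv ?_ (hG.det_ne x hx)
    simp only [Matrix.det_fin_two]
    exact ((hG.contDiffAt hx 0 0).mul (hG.contDiffAt hx 1 1)).sub
      ((hG.contDiffAt hx 0 1).mul (hG.contDiffAt hx 1 0))
  simp only [Matrix.inv_def, Matrix.adjugate_fin_two, Ring.inverse_eq_inv', Matrix.smul_apply,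
    smul_eq_mul]
  refine hd.mul ?_
  fin_cases i <;> fin_cases j <;> simp
  · exact hG.contDiffAt hx 1 1
  · exact (hG.contDiffAt hx 0 1).neg
  · exact (hG.contDiffAt hx 1 0).neg
  · exact hG.contDiffAt hx 0 0

theorem mul_inv (hG : IsMetricOn G Ω) (hx : x ∈ Ω) (i j : Fin 2) :
    ∑ l, G x i l * (G x)⁻¹ l j = if i = j then 1 else 0 := by
  have h := congrFun (congrFun (Matrix.mul_nonsing_inv (G x)
    (isUnit_iff_ne_zero.mpr (hG.det_ne x hx))) i) j
  rwa [Matrix.mul_apply, Matrix.one_apply] at h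

theorem inv_symm (hG : IsMetricOn G Ω) (hx : x ∈ Ω) (i j : Fin 2) :
    (G x)⁻¹ i j = (G x)⁻¹ j i := by
  have h : (G x).transpose = G x := by
    ext a b
    exact hG.symm x hx b a
  have h' : ((G x)⁻¹).transpose = (G x)⁻¹ := by rw [Matrix.transpose_nonsing_inv, h]
  conv_lhs => rw [← h']
  rfl

/-- The partial derivatives of the metric inherit its symmetry, since it holds near `x`. -/
theorem pd_symm (hG : IsMetricOn G Ω) (hx : x ∈ Ω) (m i j : Fin 2) :
    pd m (fun y => G y i j) x = pd m (fun y => G y j i) x :=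
  pd_congr (by filter_upwards [hG.mem_nhds hx] with y hy using hG.symm y hy i j)

theorem christoffel_symm (hG : IsMetricOn G Ω) (hx : x ∈ Ω) (k i j : Fin 2) :
    christoffel G k i j x = christoffel G k j i x := by
  simp only [christoffel, hG.pd_symm hx _ i j]
  congr 1
  refine Finset.sum_congr rfl fun l _ => ?_
  ring

theorem contDiffAt_christoffel (hG : IsMetricOn G Ω) (hx : x ∈ Ω) (k i j : Fin 2) :
    ContDiffAt ℝ ∞ (christoffel G k i j) x := by
  unfold christoffel
  refine contDiffAt_const.mul (ContDiffAt.sum fun l _ => (hG.contDiffAt_inv hx k l).mul ?_)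
  exact (((hG.contDiffAt hx _ _).pd_infty _).add ((hG.contDiffAt hx _ _).pd_infty _)).sub
    ((hG.contDiffAt hx _ _).pd_infty _)

/-- The Christoffel symbols with all indices down. -/
theorem sum_mul_christoffel (hG : IsMetricOn G Ω) (hx : x ∈ Ω) (i j n : Fin 2) :
    ∑ k, G x n k * christoffel G k i j x = (1 / 2 : ℝ) *
      (pd i (fun y => G y j n) x + pd j (fun y => G y i n) x - pd n (fun y => G y i j) x) := by
  have h0 := hG.mul_inv hx n 0
  have h1 := hG.mul_inv hx n 1
  simp only [christoffel, Fin.sum_univ_two] at h0 h1 ⊢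
  fin_cases n <;> simp at h0 h1 ⊢
  · linear_combination (1 / 2 : ℝ) * (pd i (fun y => G y j 0) x + pd j (fun y => G y i 0) x
        - pd 0 (fun y => G y i j) x) * h0 + (1 / 2 : ℝ) * (pd i (fun y => G y j 1) x
        + pd j (fun y => G y i 1) x - pd 1 (fun y => G y i j) x) * h1
  · linear_combination (1 / 2 : ℝ) * (pd i (fun y => G y j 0) x + pd j (fun y => G y i 0) x
        - pd 0 (fun y => G y i j) x) * h0 + (1 / 2 : ℝ) * (pd i (fun y => G y j 1) x
        + pd j (fun y => G y i 1) x - pd 1 (fun y => G y i j) x) * h1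

/-- Metric compatibility of the Levi-Civita connection. -/
theorem pd_metric (hG : IsMetricOn G Ω) (hx : x ∈ Ω) (m i j : Fin 2) :
    pd m (fun y => G y i j) x =
      ∑ l, (G x j l * christoffel G l m i x + G x i l * christoffel G l m j x) := by
  rw [Finset.sum_add_distrib, hG.sum_mul_christoffel hx, hG.sum_mul_christoffel hx,
    hG.pd_symm hx m j i, hG.pd_symm hx i m j, hG.pd_symm hx j m i]
  ring

/-- Metric compatibility for the inverse metric. -/
theorem pd_inv (hG : IsMetricOn G Ω) (hx : x ∈ Ω) (m i j : Fin 2) :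
    pd m (fun y => (G y)⁻¹ i j) x =
      -∑ l, (christoffel G i m l x * (G x)⁻¹ l j + christoffel G j m l x * (G x)⁻¹ i l) := by
  have hd : ∀ a b, DifferentiableAt ℝ (fun y => G y a b) x := fun a b =>
    (hG.contDiffAt hx a b).differentiableAt (by simp)
  have hi : ∀ a b, DifferentiableAt ℝ (fun y => (G y)⁻¹ a b) x := fun a b =>
    (hG.contDiffAt_inv hx a b).differentiableAt (by simp)
  set A : Matrix (Fin 2) (Fin 2) ℝ := Matrix.of fun l i => christoffel G l m i x with hA
  set D : Matrix (Fin 2) (Fin 2) ℝ := Matrix.of fun a b => pd m (fun y => G y a b) x with hD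
  set D' : Matrix (Fin 2) (Fin 2) ℝ := Matrix.of fun a b => pd m (fun y => (G y)⁻¹ a b) x with hD'
  have hu := isUnit_iff_ne_zero.mpr (hG.det_ne x hx)
  -- differentiate `G * G⁻¹ = 1`
  have key : D * (G x)⁻¹ + G x * D' = 0 := by
    ext a b
    have hab : pd m (fun y => G y a 0 * (G y)⁻¹ 0 b + G y a 1 * (G y)⁻¹ 1 b) x = 0 := by
      rw [pd_congr (F' := fun _ => if a = b then 1 else 0)]
      · exact pd_const _
      · filter_upwards [hG.mem_nhds hx] with y hy
        rw [← hG.mul_inv hy a b, Fin.sum_univ_two]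
    rw [pd_add ((hd _ _).fun_mul (hi _ _)) ((hd _ _).fun_mul (hi _ _)), pd_mul (hd _ _) (hi _ _),
      pd_mul (hd _ _) (hi _ _)] at hab
    simp only [Matrix.add_apply, Matrix.mul_apply, Fin.sum_univ_two, hD, hD', Matrix.of_apply,
      Matrix.zero_apply]
    linear_combination hab
  have hcompat : D = A.transpose * G x + G x * A := by
    ext a b
    simp only [hD, Matrix.of_apply, hG.pd_metric hx, Matrix.add_apply, Matrix.mul_apply, hA,
      Matrix.transpose_apply, Finset.sum_add_distrib]
    congr 1
    refine Finset.sum_congr rfl fun l _ => ?_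
    rw [hG.symm x hx b l, mul_comm]
  have hres : D' = -(A * (G x)⁻¹ + (G x)⁻¹ * A.transpose) := by
    calc D' = (G x)⁻¹ * (G x * D') := by rw [Matrix.nonsing_inv_mul_cancel_left _ _ hu]
      _ = (G x)⁻¹ * -(D * (G x)⁻¹) := by rw [eq_neg_of_add_eq_zero_right key]
      _ = _ := by
        rw [hcompat, Matrix.mul_neg, add_mul, mul_add, Matrix.mul_nonsing_inv_cancel_right _ _ hu,
          mul_assoc (G x), Matrix.nonsing_inv_mul_cancel_left _ _ hu, add_comm]
  have hij := congrFun (congrFun hres i) j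
  simp only [hD', hA, Matrix.of_apply, Matrix.neg_apply, Matrix.add_apply, Matrix.mul_apply,
    Matrix.transpose_apply] at hij
  rw [hij, Finset.sum_add_distrib]
  simp only [mul_comm]

end IsMetricOn


/-! ### Computing partial derivatives -/

/-- `F` is differentiable at `x` and `∂_i F(x) = c`. Keeping both facts together lets partial
derivatives of composite expressions be assembled without separate differentiability goals. -/
def HasPD (i : Fin 2) (F : Plane → ℝ) (x : Plane) (c : ℝ) : Prop :=
  DifferentiableAt ℝ F x ∧ pd i F x = c

section HasPD

variable {F F' : Plane → ℝ} {x : Plane} {i j : Fin 2} {c c' : ℝ}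

theorem _root_.DifferentiableAt.hasPD (hF : DifferentiableAt ℝ F x) (i : Fin 2) :
    HasPD i F x (pd i F x) := ⟨hF, rfl⟩

theorem _root_.ContDiffAt.hasPD {n : WithTop ℕ∞} (hF : ContDiffAt ℝ n F x) (hn : n ≠ 0)
    (i : Fin 2) : HasPD i F x (pd i F x) := ⟨hF.differentiableAt hn, rfl⟩

theorem hasPD_const (a : ℝ) : HasPD i (fun _ => a) x 0 := ⟨differentiableAt_const _, pd_const a⟩

theorem HasPD.add (h : HasPD i F x c) (h' : HasPD i F' x c') :
    HasPD i (fun y => F y + F' y) x (c + c') :=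
  ⟨h.1.fun_add h'.1, by rw [pd_add h.1 h'.1, h.2, h'.2]⟩

theorem HasPD.sub (h : HasPD i F x c) (h' : HasPD i F' x c') :
    HasPD i (fun y => F y - F' y) x (c - c') :=
  ⟨h.1.fun_sub h'.1, by rw [pd_sub h.1 h'.1, h.2, h'.2]⟩

theorem HasPD.mul (h : HasPD i F x c) (h' : HasPD i F' x c') :
    HasPD i (fun y => F y * F' y) x (c * F' x + F x * c') :=
  ⟨h.1.fun_mul h'.1, by rw [pd_mul h.1 h'.1, h.2, h'.2]⟩

theorem HasPD.const_mul (a : ℝ) (h : HasPD i F x c) : HasPD i (fun y => a * F y) x (a * c) := by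
  simpa using (hasPD_const a).mul h

theorem HasPD.sum {F : Fin 2 → Plane → ℝ} {c : Fin 2 → ℝ} (h : ∀ a, HasPD i (F a) x (c a)) :
    HasPD i (fun y => ∑ a, F a y) x (∑ a, c a) := by
  simp only [Fin.sum_univ_two]
  exact (h 0).add (h 1)

theorem HasPD.congr (h : HasPD i F x c) (hF : F' =ᶠ[𝓝 x] F) : HasPD i F' x c :=
  ⟨h.1.congr_of_eventuallyEq hF, by rw [pd_congr hF, h.2]⟩

end HasPD

/-! ### Gradient, Hessian and Laplacian -/

/-- The components `∇_i ∇_l ∇_a f` of the covariant derivative of the Hessian. -/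
def covDerivHess (G : Plane → Matrix (Fin 2) (Fin 2) ℝ) (f : Plane → ℝ) (i l a : Fin 2)
    (x : Plane) : ℝ :=
  pd i (covHess G f l a) x - ∑ m, christoffel G m i l x * covHess G f m a x
    - ∑ m, christoffel G m i a x * covHess G f l m x

theorem two_le_infty : (2 : WithTop ℕ∞) ≤ ∞ :=
  WithTop.coe_le_coe.mpr (le_top : (2 : ℕ∞) ≤ ⊤)

namespace IsMetricOn

variable {G : Plane → Matrix (Fin 2) (Fin 2) ℝ} {Ω : Set Plane} {x : Plane} {f h k : Plane → ℝ}

theorem hasPD_inv (hG : IsMetricOn G Ω) (hx : x ∈ Ω) (m i j : Fin 2) :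
    HasPD m (fun y => (G y)⁻¹ i j) x
      (-∑ l, (christoffel G i m l x * (G x)⁻¹ l j + christoffel G j m l x * (G x)⁻¹ i l)) :=
  ⟨(hG.contDiffAt_inv hx i j).differentiableAt (by simp), hG.pd_inv hx m i j⟩

theorem hasPD_christoffel (hG : IsMetricOn G Ω) (hx : x ∈ Ω) (m k i j : Fin 2) :
    HasPD m (christoffel G k i j) x (pd m (christoffel G k i j) x) :=
  (hG.contDiffAt_christoffel hx k i j).hasPD (by simp) m

theorem covHess_symm (hG : IsMetricOn G Ω) (hx : x ∈ Ω) (hf : ContDiffAt ℝ 2 f x) (i j : Fin 2) :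
    covHess G f i j x = covHess G f j i x := by
  simp only [covHess, pd_comm hf i j, hG.christoffel_symm hx _ i j]

theorem contDiffAt_covHess (hG : IsMetricOn G Ω) (hx : x ∈ Ω) {m n : WithTop ℕ∞}
    (hf : ContDiffAt ℝ n f x) (hmn : m + 1 + 1 ≤ n) (hm : m ≤ ∞) (i j : Fin 2) :
    ContDiffAt ℝ m (covHess G f i j) x := by
  refine ((hf.pd hmn j).pd le_rfl i).sub (ContDiffAt.sum fun a _ => ?_)
  exact ((hG.contDiffAt_christoffel hx _ _ _).of_le hm).mul
    ((hf.pd hmn a).of_le le_self_add)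

/-- The product rule `∂_m ⟨∇f, ∇h⟩ = Hess f (∂_m, ∇h) + Hess h (∂_m, ∇f)`. -/
theorem hasPD_gradInner (hG : IsMetricOn G Ω) (hx : x ∈ Ω) (hf : ContDiffAt ℝ 2 f x)
    (hh : ContDiffAt ℝ 2 h x) (m : Fin 2) :
    HasPD m (gradInner G f h) x (∑ i, ∑ j, (G x)⁻¹ i j *
      (covHess G f m i x * pd j h x + pd i f x * covHess G h m j x)) := by
  have hf' := fun i => (hf.pd (m := 1) le_rfl i).hasPD one_ne_zero m
  have hh' := fun i => (hh.pd (m := 1) le_rfl i).hasPD one_ne_zero m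
  have H := HasPD.sum fun i => HasPD.sum fun j =>
    ((hG.hasPD_inv hx m i j).mul (hf' i)).mul (hh' j)
  refine ⟨H.1, H.2.trans ?_⟩
  simp only [covHess, Fin.sum_univ_two]
  ring

theorem contDiffAt_gradInner (hG : IsMetricOn G Ω) (hx : x ∈ Ω) {m n : WithTop ℕ∞}
    (hf : ContDiffAt ℝ n f x) (hh : ContDiffAt ℝ n h x) (hmn : m + 1 ≤ n) (hm : m ≤ ∞) :
    ContDiffAt ℝ m (gradInner G f h) x :=
  ContDiffAt.sum fun i _ => ContDiffAt.sum fun j _ =>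
    (((hG.contDiffAt_inv hx i j).of_le hm).mul (hf.pd hmn i)).mul (hh.pd hmn j)

theorem hessC_eq (hG : IsMetricOn G Ω) (hx : x ∈ Ω) (hf : ContDiffAt ℝ 2 f x) (i k : Fin 2) :
    hessC G f x i k = ∑ l, (G x)⁻¹ k l * covHess G f i l x := by
  have hf' := fun j => (hf.pd (m := 1) le_rfl j).hasPD one_ne_zero i
  have H := HasPD.sum fun l => (hG.hasPD_inv hx i k l).mul (hf' l)
  have H' : pd i (fun y => gradC G f y k) x = _ := H.2
  simp only [hessC, covDeriv, coordField]
  rw [Finset.sum_eq_single i (fun b _ hb => by simp [hb]) (by simp), H']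
  simp only [covHess, gradC, Fin.sum_univ_two, Pi.single_eq_same]
  ring

theorem laplacianC_eq (hG : IsMetricOn G Ω) (hx : x ∈ Ω) (hf : ContDiffAt ℝ 2 f x) :
    laplacianC G f x = ∑ i, ∑ l, (G x)⁻¹ i l * covHess G f i l x := by
  simp only [laplacianC, hG.hessC_eq hx hf]

/-- The inner product of the vectors obtained from two covectors by raising the index. -/
theorem innerC_sharp (hG : IsMetricOn G Ω) (hx : x ∈ Ω) (v w : Fin 2 → ℝ) :
    innerC G x (fun k => ∑ l, (G x)⁻¹ k l * v l) (fun k => ∑ l, (G x)⁻¹ k l * w l) =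
      ∑ i, ∑ j, (G x)⁻¹ i j * v i * w j := by
  have h00 := hG.mul_inv hx 0 0
  have h01 := hG.mul_inv hx 0 1
  have h10 := hG.mul_inv hx 1 0
  have h11 := hG.mul_inv hx 1 1
  have hs := hG.inv_symm hx 1 0
  simp only [innerC, Fin.sum_univ_two, hs] at *
  norm_num at h00 h01 h10 h11
  set a := (G x)⁻¹ 0 0
  set b := (G x)⁻¹ 0 1
  set c := (G x)⁻¹ 1 1
  linear_combination (a * v 0 + b * v 1) * (w 0 * h00 + w 1 * h01)
    + (b * v 0 + c * v 1) * (w 0 * h10 + w 1 * h11)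

theorem innerC_gradC (hG : IsMetricOn G Ω) (hx : x ∈ Ω) (f h : Plane → ℝ) :
    innerC G x (gradC G f x) (gradC G h x) = gradInner G f h x :=
  hG.innerC_sharp hx (fun l => pd l f x) (fun l => pd l h x)

theorem hessNormSqC_eq (hG : IsMetricOn G Ω) (hx : x ∈ Ω) (hf : ContDiffAt ℝ 2 f x) :
    hessNormSqC G f x = ∑ i, ∑ j, ∑ a, ∑ b, (G x)⁻¹ i j * (G x)⁻¹ a b *
      covHess G f i a x * covHess G f j b x := by
  have H : ∀ i, hessC G f x i = fun k => ∑ l, (G x)⁻¹ k l * covHess G f i l x := fun i =>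
    funext fun k => hG.hessC_eq hx hf i k
  simp only [hessNormSqC, H]
  simp only [hG.innerC_sharp hx (fun l => covHess G f _ l x) (fun l => covHess G f _ l x),
    Finset.mul_sum, mul_assoc]

/-! ### Curvature -/

theorem _root_.GLSurface.curvC_eq (G : Plane → Matrix (Fin 2) (Fin 2) ℝ) (x : Plane)
    (i j k l : Fin 2) :
    curvC G i j k x l = pd i (christoffel G l j k) x - pd j (christoffel G l i k) x
      + ∑ m, (christoffel G l i m x * christoffel G m j k x
        - christoffel G l j m x * christoffel G m i k x) := by
  have h1 : ∀ (i j : Fin 2) (y : Plane) (n : Fin 2),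
      covDeriv G (coordField i) (coordField j) y n = christoffel G n i j y := by
    intro i j y n
    simp only [covDeriv, coordField]
    rw [Finset.sum_eq_single i (fun b _ hb => by simp [hb]) (by simp)]
    rw [Finset.sum_eq_single j (fun b _ hb => by simp [hb]) (by simp)]
    simp [pd_const]
  have h2 : ∀ (i j : Fin 2) , covDeriv G (coordField i) (covDeriv G (coordField j) (coordField k))
      x l = pd i (christoffel G l j k) x
        + ∑ m, christoffel G l i m x * christoffel G m j k x := by
    intro i j
    rw [covDeriv]
    simp only [h1]
    rw [Finset.sum_eq_single i (fun b _ hb => by simp [coordField, hb]) (by simp)]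
    simp [coordField]
  rw [curvC, Pi.sub_apply, h2, h2, Finset.sum_sub_distrib]
  ring

/-- Raising an index of the curvature gives a form that is skew, because second derivatives of the
inverse metric commute. -/
theorem curvC_skew (hG : IsMetricOn G Ω) (hx : x ∈ Ω) (m n : Fin 2) :
    ∑ l, (curvC G 0 1 l x m * (G x)⁻¹ l n + curvC G 0 1 l x n * (G x)⁻¹ m l) = 0 := by
  have hpd : ∀ i j, HasPD i (pd j (fun y => (G y)⁻¹ m n)) x _ := fun i j =>
    HasPD.congr (HasPD.const_mul (-1) (HasPD.sum fun l =>
      ((hG.hasPD_christoffel hx i m j l).mul (hG.hasPD_inv hx i l n)).add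
      ((hG.hasPD_christoffel hx i n j l).mul (hG.hasPD_inv hx i m l)))) (by
        filter_upwards [hG.mem_nhds hx] with y hy
        rw [hG.pd_inv hy, neg_one_mul])
  have hc := pd_comm ((hG.contDiffAt_inv hx m n).of_le (m := 2) two_le_infty) 0 1
  rw [(hpd 0 1).2, (hpd 1 0).2] at hc
  simp only [curvC_eq]
  simp only [Fin.sum_univ_two] at hc ⊢
  linear_combination -hc

/-- On a surface the curvature with one index raised is `K ε^{mn}`. -/
theorem curvC_raise (hG : IsMetricOn G Ω) (hx : x ∈ Ω) :
    (∑ l, curvC G 0 1 l x 0 * (G x)⁻¹ l 0 = 0) ∧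
    (∑ l, curvC G 0 1 l x 1 * (G x)⁻¹ l 1 = 0) ∧
    (∑ l, curvC G 0 1 l x 0 * (G x)⁻¹ l 1 = gaussC G x) ∧
    (∑ l, curvC G 0 1 l x 1 * (G x)⁻¹ l 0 = -gaussC G x) := by
  have s00 := hG.curvC_skew hx 0 0
  have s01 := hG.curvC_skew hx 0 1
  have s11 := hG.curvC_skew hx 1 1
  have hs := hG.inv_symm hx 1 0
  have hgs := hG.symm x hx 1 0
  have h00 := hG.mul_inv hx 0 0
  have h01 := hG.mul_inv hx 0 1
  have h10 := hG.mul_inv hx 1 0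
  have h11 := hG.mul_inv hx 1 1
  have hdet := hG.det_ne x hx
  have e0 : ∑ l, curvC G 0 1 l x 0 * (G x)⁻¹ l 0 = 0 := by
    simp only [Fin.sum_univ_two, hs] at s00 ⊢
    linear_combination s00 / 2
  have e1 : ∑ l, curvC G 0 1 l x 1 * (G x)⁻¹ l 1 = 0 := by
    simp only [Fin.sum_univ_two, hs] at s11 ⊢
    linear_combination s11 / 2
  have eK : ∑ l, curvC G 0 1 l x 0 * (G x)⁻¹ l 1 = gaussC G x := by
    rw [gaussC, eq_div_iff hdet, Matrix.det_fin_two]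
    simp only [innerC, coordField, Fin.sum_univ_two, hs, hgs] at *
    norm_num at h00 h01 h10 h11 ⊢
    set a := (G x)⁻¹ 0 0
    set b := (G x)⁻¹ 0 1
    set c := (G x)⁻¹ 1 1
    set K := curvC G 0 1 0 x 0 * b + curvC G 0 1 1 x 0 * c with hK
    have hp : curvC G 0 1 1 x 0 = K * G x 1 1 := by
      linear_combination -curvC G 0 1 1 x 0 * h11 - curvC G 0 1 0 x 0 * h10 + G x 0 1 * e0
    have hq : curvC G 0 1 1 x 1 = -K * G x 0 1 := by
      linear_combination -curvC G 0 1 1 x 1 * h11 - curvC G 0 1 0 x 1 * h10 + G x 0 1 * s01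
        + G x 1 1 * e1
    rw [hp, hq]
    ring
  refine ⟨e0, e1, eK, ?_⟩
  rw [← eK]
  simp only [Fin.sum_univ_two, hs] at s01 ⊢
  linear_combination s01

/-! ### Bochner's formula -/

/-- The Ricci identity for the second covariant derivatives of `df`. -/
theorem covDerivHess_sub (hG : IsMetricOn G Ω) (hx : x ∈ Ω) (hf : ContDiffAt ℝ 3 f x) (l : Fin 2) :
    covDerivHess G f 0 1 l x - covDerivHess G f 1 0 l x =
      -∑ m, curvC G 0 1 l x m * pd m f x := by
  have hf1 := fun j => hf.pd (m := 2) le_rfl j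
  have hpd : ∀ i j, HasPD i (covHess G f j l) x _ := fun i j =>
    (((hf1 l).pd (m := 1) le_rfl j).hasPD one_ne_zero i).sub (HasPD.sum fun m =>
      (hG.hasPD_christoffel hx i m j l).mul ((hf1 m).hasPD two_ne_zero i))
  have hc := pd_comm (hf1 l) 0 1
  have hs := fun m => hG.christoffel_symm hx m 1 0
  simp only [covDerivHess, (hpd _ _).2, curvC_eq]
  simp only [covHess, Fin.sum_univ_two, hs, pd_comm (hf.of_le (by norm_num)) 1 0]
  linear_combination hc

/-- The traced Ricci identity: the Ricci curvature of a surface is `K g`. -/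
theorem sum_covDerivHess_sub (hG : IsMetricOn G Ω) (hx : x ∈ Ω) (hf : ContDiffAt ℝ 3 f x)
    (a : Fin 2) :
    ∑ i, ∑ l, (G x)⁻¹ i l * (covDerivHess G f i a l x - covDerivHess G f a i l x) =
      gaussC G x * pd a f x := by
  have h0 := hG.covDerivHess_sub hx hf 0
  have h1 := hG.covDerivHess_sub hx hf 1
  obtain ⟨c0, c1, c2, c3⟩ := hG.curvC_raise hx
  have hs := hG.inv_symm hx 1 0
  simp only [Fin.sum_univ_two, hs] at *
  fin_cases a <;> simp only [Fin.zero_eta, Fin.mk_one]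
  · linear_combination -(G x)⁻¹ 0 1 * h0 - (G x)⁻¹ 1 1 * h1 + pd 0 f x * c2 + pd 1 f x * c1
  · linear_combination (G x)⁻¹ 0 0 * h0 + (G x)⁻¹ 0 1 * h1 - pd 0 f x * c0 - pd 1 f x * c3

/-- Traces commute with the covariant derivative. -/
theorem pd_laplacianC (hG : IsMetricOn G Ω) (hx : x ∈ Ω) (hf : ContDiffAt ℝ 3 f x) (a : Fin 2) :
    pd a (laplacianC G f) x = ∑ i, ∑ l, (G x)⁻¹ i l * covDerivHess G f a i l x := by
  have hF := fun i l => (hG.contDiffAt_covHess hx (m := 1) hf le_rfl (by simp) i l).hasPD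
    one_ne_zero a
  have H : HasPD a (laplacianC G f) x _ :=
    (HasPD.sum fun i => HasPD.sum fun l => (hG.hasPD_inv hx a i l).mul (hF i l)).congr (by
      filter_upwards [hG.mem_nhds hx, hf.eventually (by simp)] with y hy hfy
      exact hG.laplacianC_eq hy (hfy.of_le (by norm_num)))
  rw [H.2]
  simp only [covDerivHess, Fin.sum_univ_two, hG.inv_symm hx 1 0]
  ring

/-- Bochner's formula on a surface. -/
theorem laplacianC_gradInner (hG : IsMetricOn G Ω) (hx : x ∈ Ω) (hf : ContDiffAt ℝ 3 f x) :
    laplacianC G (gradInner G f f) x = 2 * (hessNormSqC G f x + gradInner G f (laplacianC G f) x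
      + gaussC G x * gradInner G f f x) := by
  have hf2 : ContDiffAt ℝ 2 f x := hf.of_le (by norm_num)
  have hF := fun i l m => (hG.contDiffAt_covHess hx (m := 1) hf le_rfl (by simp) i l).hasPD
    one_ne_zero m
  have hf1 := fun i m => (hf.pd (m := 2) le_rfl i).hasPD two_ne_zero m
  have he : ∀ i l, HasPD i (pd l (gradInner G f f)) x _ := fun i l =>
    (HasPD.sum fun a => HasPD.sum fun b => (hG.hasPD_inv hx i a b).mul
      (((hF l a i).mul (hf1 b i)).add ((hf1 a i).mul (hF l b i)))).congr (by
        filter_upwards [hG.mem_nhds hx, hf.eventually (by simp)] with y hy hfy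
        have hfy2 : ContDiffAt ℝ 2 f y := hfy.of_le (by norm_num)
        exact (hG.hasPD_gradInner hy hfy2 hfy2 l).2)
  have hs := hG.inv_symm hx 1 0
  -- the covariant Hessian of `|∇f|²`
  have hcov : ∀ i l, covHess G (gradInner G f f) i l x = 2 * ∑ a, ∑ b, (G x)⁻¹ a b *
      (covDerivHess G f i l a x * pd b f x + covHess G f l a x * covHess G f i b x) := by
    intro i l
    rw [covHess, (he i l).2]
    simp only [(hG.hasPD_gradInner hx hf2 hf2 _).2]
    have hpp : ∀ b, pd i (pd b f) x = covHess G f i b x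
        + ∑ m, christoffel G m i b x * pd m f x := fun b => by simp only [covHess]; ring
    simp only [hpp, covDerivHess, Fin.sum_univ_two, hs]
    ring
  have hB := hG.sum_covDerivHess_sub hx hf
  have hD := hG.pd_laplacianC hx hf
  rw [hG.laplacianC_eq hx (hG.contDiffAt_gradInner hx hf hf le_rfl two_le_infty),
    hG.hessNormSqC_eq hx hf2]
  have hDs : ∀ i l a, covDerivHess G f i l a x = covDerivHess G f i a l x := by
    intro i l a
    have : pd i (covHess G f l a) x = pd i (covHess G f a l) x := pd_congr (by
      filter_upwards [hG.mem_nhds hx, hf.eventually (by simp)] with y hy hfy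
      exact hG.covHess_symm hy (hfy.of_le (by norm_num)) l a)
    simp only [covDerivHess, this, hG.covHess_symm hx hf2 _ l, hG.covHess_symm hx hf2 _ a]
    ring
  have hFs := hG.covHess_symm hx hf2 1 0
  simp only [hcov]
  simp only [gradInner, hD]
  have b0 := hB 0
  have b1 := hB 1
  simp only [Fin.sum_univ_two, hs, hFs, hDs _ 1 0] at b0 b1 ⊢
  linear_combination 2 * ((G x)⁻¹ 0 0 * pd 0 f x + (G x)⁻¹ 0 1 * pd 1 f x) * b0
    + 2 * ((G x)⁻¹ 0 1 * pd 0 f x + (G x)⁻¹ 1 1 * pd 1 f x) * b1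

end IsMetricOn


/-! ### Sums and products under the Laplacian -/

section LaplacianAlgebra

variable {G : Plane → Matrix (Fin 2) (Fin 2) ℝ} {Ω : Set Plane} {x : Plane} {f h k : Plane → ℝ}

/-- The Laplacian at a point depends only on the germ of the function. -/
theorem laplacianC_congr (hfh : f =ᶠ[𝓝 x] h) : laplacianC G f x = laplacianC G h x := by
  have hg : ∀ k : Fin 2, (fun y => gradC G f y k) =ᶠ[𝓝 x] fun y => gradC G h y k := fun k => by
    filter_upwards [hfh.eventuallyEq_nhds] with y hy
    simp only [gradC, pd_congr hy]
  simp only [laplacianC, hessC, covDeriv, pd_congr (hg _), (hg _).eq_of_nhds]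

namespace IsMetricOn

theorem laplacianC_add (hG : IsMetricOn G Ω) (hx : x ∈ Ω) (hf : ContDiffAt ℝ 2 f x)
    (hh : ContDiffAt ℝ 2 h x) :
    laplacianC G (fun y => f y + h y) x = laplacianC G f x + laplacianC G h x := by
  have hp : ∀ j, pd j (fun y => f y + h y) =ᶠ[𝓝 x] fun y => pd j f y + pd j h y := fun j => by
    filter_upwards [hf.eventually (by simp), hh.eventually (by simp)] with y hfy hhy
    exact pd_add (hfy.differentiableAt two_ne_zero) (hhy.differentiableAt two_ne_zero)
  have hpp : ∀ i j, pd i (pd j (fun y => f y + h y)) x = _ := fun i j =>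
    ((((hf.pd (m := 1) le_rfl j).hasPD one_ne_zero i).add
      ((hh.pd (m := 1) le_rfl j).hasPD one_ne_zero i)).congr (hp j)).2
  rw [hG.laplacianC_eq hx hf, hG.laplacianC_eq hx hh, hG.laplacianC_eq hx (hf.add hh)]
  simp only [covHess, hpp, (hp _).eq_of_nhds, Fin.sum_univ_two]
  ring

theorem laplacianC_mul (hG : IsMetricOn G Ω) (hx : x ∈ Ω) (hf : ContDiffAt ℝ 2 f x)
    (hh : ContDiffAt ℝ 2 h x) :
    laplacianC G (fun y => f y * h y) x =
      laplacianC G f x * h x + 2 * gradInner G f h x + f x * laplacianC G h x := by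
  have hp : ∀ j, pd j (fun y => f y * h y) =ᶠ[𝓝 x] fun y => pd j f y * h y + f y * pd j h y :=
    fun j => by
      filter_upwards [hf.eventually (by simp), hh.eventually (by simp)] with y hfy hhy
      exact pd_mul (hfy.differentiableAt two_ne_zero) (hhy.differentiableAt two_ne_zero)
  have hpp : ∀ i j, pd i (pd j (fun y => f y * h y)) x = _ := fun i j =>
    (((((hf.pd (m := 1) le_rfl j).hasPD one_ne_zero i).mul (hh.hasPD two_ne_zero i)).add
      ((hf.hasPD two_ne_zero i).mul
        ((hh.pd (m := 1) le_rfl j).hasPD one_ne_zero i))).congr (hp j)).2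
  rw [hG.laplacianC_eq hx hf, hG.laplacianC_eq hx hh, hG.laplacianC_eq hx (hf.mul hh)]
  simp only [gradInner, covHess, hpp, (hp _).eq_of_nhds, Fin.sum_univ_two, hG.inv_symm hx 1 0]
  ring

theorem laplacianC_const (hG : IsMetricOn G Ω) (hx : x ∈ Ω) (c : ℝ) :
    laplacianC G (fun _ => c) x = 0 := by
  have h : ∀ i, pd i (fun _ : Plane => c) = fun _ => 0 := fun i => funext fun y => pd_const c
  rw [hG.laplacianC_eq hx contDiffAt_const]
  simp [covHess, h, pd_const]

theorem laplacianC_const_mul (hG : IsMetricOn G Ω) (hx : x ∈ Ω) (c : ℝ)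
    (hf : ContDiffAt ℝ 2 f x) :
    laplacianC G (fun y => c * f y) x = c * laplacianC G f x := by
  rw [hG.laplacianC_mul hx contDiffAt_const hf, hG.laplacianC_const hx]
  simp [gradInner, pd_const]

/-! ### Invariance of the Laplacian under change of coordinates -/

theorem sum_mul_inv_mul_inv (hG : IsMetricOn G Ω) (hx : x ∈ Ω) (T : Fin 2 → Fin 2 → ℝ) :
    ∑ a, ∑ b, G x a b * ∑ i, ∑ j, (G x)⁻¹ i a * (G x)⁻¹ j b * T i j =
      ∑ i, ∑ j, (G x)⁻¹ i j * T i j := by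
  have h00 := hG.mul_inv hx 0 0
  have h01 := hG.mul_inv hx 0 1
  have h10 := hG.mul_inv hx 1 0
  have h11 := hG.mul_inv hx 1 1
  have hs := hG.inv_symm hx 1 0
  simp only [Fin.sum_univ_two, hs] at *
  norm_num at h00 h01 h10 h11
  set a := (G x)⁻¹ 0 0
  set b := (G x)⁻¹ 0 1
  set c := (G x)⁻¹ 1 1
  linear_combination (a * T 0 0 + b * T 1 0) * h00 + (a * T 0 1 + b * T 1 1) * h01
    + (b * T 0 0 + c * T 1 0) * h10 + (b * T 0 1 + c * T 1 1) * h11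

/-- The Hessian is determined by the inner products of gradients. -/
theorem gradInner_polarization (hG : IsMetricOn G Ω) (hx : x ∈ Ω) (hf : ContDiffAt ℝ 2 f x)
    (hh : ContDiffAt ℝ 2 h x) (hk : ContDiffAt ℝ 2 k x) :
    gradInner G h (gradInner G f k) x + gradInner G k (gradInner G f h) x
      - gradInner G f (gradInner G h k) x =
    2 * ∑ i, ∑ j, (∑ a, (G x)⁻¹ i a * pd a h x) * (∑ b, (G x)⁻¹ j b * pd b k x)
      * covHess G f i j x := by
  have e1 := fun m => (hG.hasPD_gradInner hx hf hk m).2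
  have e2 := fun m => (hG.hasPD_gradInner hx hf hh m).2
  have e3 := fun m => (hG.hasPD_gradInner hx hh hk m).2
  rw [gradInner, gradInner.eq_def G k, gradInner.eq_def G f (gradInner G h k)]
  simp only [e1, e2, e3, Fin.sum_univ_two, hG.inv_symm hx 1 0, hG.covHess_symm hx hf 1 0,
    hG.covHess_symm hx hh 1 0, hG.covHess_symm hx hk 1 0]
  ring

end IsMetricOn

/-- The smooth map `φ` pulls the metric `G` on `Ω` back to the metric `G'` on `Ω'`. -/
structure IsPullbackOn (φ : Plane → Plane) (G' G : Plane → Matrix (Fin 2) (Fin 2) ℝ)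
    (Ω' Ω : Set Plane) : Prop where
  source : IsMetricOn G' Ω'
  target : IsMetricOn G Ω
  mapsTo : ∀ y ∈ Ω', φ y ∈ Ω
  contDiffAt : ∀ y ∈ Ω', ContDiffAt ℝ ∞ φ y
  pullback : ∀ y ∈ Ω', ∀ i j, G' y i j =
    ∑ a, ∑ b, G (φ y) a b * pd i (fun z => φ z a) y * pd j (fun z => φ z b) y

namespace IsPullbackOn

variable {φ : Plane → Plane} {G' : Plane → Matrix (Fin 2) (Fin 2) ℝ} {Ω' : Set Plane}

theorem contDiffAt_apply (hφ : IsPullbackOn φ G' G Ω' Ω) (hx : x ∈ Ω') (a : Fin 2) :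
    ContDiffAt ℝ ∞ (fun z => φ z a) x :=
  contDiffAt_euclidean.mp (hφ.contDiffAt x hx) a

theorem pd_comp (hφ : IsPullbackOn φ G' G Ω' Ω) (hx : x ∈ Ω')
    (hf : DifferentiableAt ℝ f (φ x)) (i : Fin 2) :
    pd i (fun y => f (φ y)) x = ∑ a, pd i (fun z => φ z a) x * pd a f (φ x) :=
  GLSurface.pd_comp hf ((hφ.contDiffAt x hx).differentiableAt (by simp))

/-- The inverse metric of the target is the push-forward of that of the source. -/
theorem inv_eq (hφ : IsPullbackOn φ G' G Ω' Ω) (hx : x ∈ Ω') (a b : Fin 2) :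
    (G (φ x))⁻¹ a b =
      ∑ i, ∑ j, (G' x)⁻¹ i j * pd i (fun z => φ z a) x * pd j (fun z => φ z b) x := by
  set J : Matrix (Fin 2) (Fin 2) ℝ := Matrix.of fun a i => pd i (fun z => φ z a) x with hJ
  have h1 : G' x = J.transpose * G (φ x) * J := by
    ext i j
    simp only [hφ.pullback x hx, Matrix.mul_apply, Fin.sum_univ_two, hJ, Matrix.transpose_apply,
      Matrix.of_apply]
    ring
  have hdet := hφ.source.det_ne x hx
  have hJdet : IsUnit J.det := by
    rw [h1, Matrix.det_mul] at hdet
    exact isUnit_iff_ne_zero.mpr (right_ne_zero_of_mul hdet)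
  have hJt : IsUnit J.transpose.det := by rwa [Matrix.det_transpose]
  have h2 : (G (φ x))⁻¹ = J * (G' x)⁻¹ * J.transpose := by
    rw [h1, Matrix.mul_inv_rev, Matrix.mul_inv_rev, Matrix.mul_nonsing_inv_cancel_left _ _ hJdet,
      Matrix.nonsing_inv_mul_cancel_right _ _ hJt]
  rw [h2]
  simp only [Matrix.mul_apply, Fin.sum_univ_two, hJ, Matrix.transpose_apply, Matrix.of_apply]
  ring

/-- The inner product of gradients commutes with changes of coordinates. -/
theorem gradInner_comp (hφ : IsPullbackOn φ G' G Ω' Ω) (hx : x ∈ Ω')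
    (hf : DifferentiableAt ℝ f (φ x)) (hh : DifferentiableAt ℝ h (φ x)) :
    gradInner G' (fun y => f (φ y)) (fun y => h (φ y)) x = gradInner G f h (φ x) := by
  simp only [gradInner, hφ.pd_comp hx hf, hφ.pd_comp hx hh, hφ.inv_eq hx, Fin.sum_univ_two]
  ring

theorem gradInner_comp_gradInner (hφ : IsPullbackOn φ G' G Ω' Ω) (hx : x ∈ Ω')
    (hf : ContDiffAt ℝ 2 f (φ x)) (hh : ContDiffAt ℝ 2 h (φ x)) (hk : ContDiffAt ℝ 2 k (φ x)) :
    gradInner G' (fun y => h (φ y))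
      (gradInner G' (fun y => f (φ y)) (fun y => k (φ y))) x =
    gradInner G h (gradInner G f k) (φ x) := by
  have hc := (hφ.contDiffAt x hx).continuousAt
  have hev : gradInner G' (fun y => f (φ y)) (fun y => k (φ y)) =ᶠ[𝓝 x]
      fun y => gradInner G f k (φ y) := by
    filter_upwards [hφ.source.mem_nhds hx, hc.eventually (hf.eventually (by simp)),
      hc.eventually (hk.eventually (by simp))] with y hy hfy hky
    exact hφ.gradInner_comp hy (hfy.differentiableAt two_ne_zero)
      (hky.differentiableAt two_ne_zero)
  have hd : DifferentiableAt ℝ (gradInner G f k) (φ x) :=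
    (hφ.target.hasPD_gradInner (hφ.mapsTo x hx) hf hk 0).1
  rw [← hφ.gradInner_comp hx (hh.differentiableAt two_ne_zero) hd, gradInner, gradInner]
  simp only [pd_congr hev]

/-- The Laplacian commutes with changes of coordinates. By polarization the Hessian of `f`,
evaluated on the gradients of the coordinate functions, is made of inner products of gradients,
for which the chain rule suffices; its trace is the Laplacian. -/
theorem laplacianC_comp (hφ : IsPullbackOn φ G' G Ω' Ω) (hx : x ∈ Ω')
    (hf : ContDiffAt ℝ 2 f (φ x)) :
    laplacianC G' (fun y => f (φ y)) x = laplacianC G f (φ x) := by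
  have hφx := hφ.mapsTo x hx
  have hfφ : ContDiffAt ℝ 2 (fun y => f (φ y)) x :=
    hf.comp x ((hφ.contDiffAt x hx).of_le two_le_infty)
  have hcoord : ∀ a : Fin 2, ContDiffAt ℝ 2 (fun z : Plane => z a) (φ x) := fun a =>
    contDiffAt_euclidean.mp contDiffAt_id a
  have hcoord' : ∀ a : Fin 2, ContDiffAt ℝ 2 (fun z : Plane => φ z a) x := fun a =>
    (hφ.contDiffAt_apply hx a).of_le two_le_infty
  have key : ∀ a b, ∑ i, ∑ j, (∑ c, (G' x)⁻¹ i c * pd c (fun z => φ z a) x)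
      * (∑ c, (G' x)⁻¹ j c * pd c (fun z => φ z b) x) * covHess G' (fun y => f (φ y)) i j x =
      ∑ i, ∑ j, (G (φ x))⁻¹ i a * (G (φ x))⁻¹ j b * covHess G f i j (φ x) := by
    intro a b
    have h1 := hφ.source.gradInner_polarization hx hfφ (hcoord' a) (hcoord' b)
    have h2 := hφ.target.gradInner_polarization hφx hf (hcoord a) (hcoord b)
    rw [hφ.gradInner_comp_gradInner hx hf (hcoord a) (hcoord b),
      hφ.gradInner_comp_gradInner hx hf (hcoord b) (hcoord a),
      hφ.gradInner_comp_gradInner hx (hcoord a) hf (hcoord b), h2] at h1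
    have h3 := mul_left_cancel₀ two_ne_zero h1
    rw [← h3]
    simp [pd_coord]
  have hpull := hφ.pullback x hx
  rw [hφ.source.laplacianC_eq hx hfφ, hφ.target.laplacianC_eq hφx hf]
  trans ∑ a, ∑ b, G (φ x) a b * ∑ i, ∑ j, (∑ c, (G' x)⁻¹ i c * pd c (fun z => φ z a) x)
      * (∑ c, (G' x)⁻¹ j c * pd c (fun z => φ z b) x) * covHess G' (fun y => f (φ y)) i j x
  · rw [← hφ.source.sum_mul_inv_mul_inv hx]
    simp only [hpull, Fin.sum_univ_two]
    ring
  · simp only [key]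
    exact hφ.target.sum_mul_inv_mul_inv hφx fun i j => covHess G f i j (φ x)

end IsPullbackOn

end LaplacianAlgebra


/-! ### Functions of space and time -/

section SpaceTime

variable {V : Plane → ℝ → ℝ} {x : Plane} {t : ℝ} {m n : WithTop ℕ∞}

theorem pd_slice (hV : DifferentiableAt ℝ (fun z : Plane × ℝ => V z.1 z.2) (x, t)) (i : Fin 2) :
    pd i (fun y => V y t) x =
      fderiv ℝ (fun z : Plane × ℝ => V z.1 z.2) (x, t) (EuclideanSpace.single i 1, 0) := by
  have h : HasFDerivAt (fun y => V y t) _ x :=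
    HasFDerivAt.comp x (f := fun y : Plane => (y, t)) hV.hasFDerivAt (hasFDerivAt_prodMk_left x t)
  rw [pd, h.fderiv]
  simp

theorem hasDerivAt_slice (hV : DifferentiableAt ℝ (fun z : Plane × ℝ => V z.1 z.2) (x, t)) :
    HasDerivAt (V x) (fderiv ℝ (fun z : Plane × ℝ => V z.1 z.2) (x, t) (0, 1)) t := by
  have h : HasFDerivAt (fun s => V x s) _ t :=
    HasFDerivAt.comp t (f := fun s : ℝ => (x, s)) hV.hasFDerivAt (hasFDerivAt_prodMk_right x t)
  simpa using h.hasDerivAt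

theorem contDiffAt_slice (hV : ContDiffAt ℝ n (fun z : Plane × ℝ => V z.1 z.2) (x, t)) :
    ContDiffAt ℝ n (fun y => V y t) x :=
  hV.comp x (contDiffAt_id.prodMk contDiffAt_const)

theorem eventually_differentiableAt (hV : ContDiffAt ℝ n (fun z : Plane × ℝ => V z.1 z.2) (x, t))
    (hn : 1 ≤ n) : ∀ᶠ z : Plane × ℝ in 𝓝 (x, t),
      DifferentiableAt ℝ (fun z : Plane × ℝ => V z.1 z.2) (z.1, z.2) := by
  filter_upwards [(hV.of_le hn).eventually (by simp)] with z hz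
  exact hz.differentiableAt one_ne_zero

theorem contDiffAt_pd_slice (hV : ContDiffAt ℝ n (fun z : Plane × ℝ => V z.1 z.2) (x, t))
    (hmn : m + 1 ≤ n) (i : Fin 2) :
    ContDiffAt ℝ m (fun z : Plane × ℝ => pd i (fun y => V y z.2) z.1) (x, t) := by
  refine ((hV.fderiv_right hmn).clm_apply
    (contDiffAt_const (c := (EuclideanSpace.single i (1 : ℝ), (0 : ℝ))))).congr_of_eventuallyEq ?_
  filter_upwards [eventually_differentiableAt hV (le_add_self.trans hmn)] with z hz
  exact pd_slice hz i

/-- Partial derivatives in space commute with the derivative in time. -/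
theorem hasDerivAt_pd_slice (hV : ContDiffAt ℝ 2 (fun z : Plane × ℝ => V z.1 z.2) (x, t))
    (i : Fin 2) : HasDerivAt (fun s => pd i (fun y => V y s) x)
      (pd i (fun y => deriv (V y) t) x) t := by
  set W := fderiv ℝ (fun z : Plane × ℝ => V z.1 z.2) with hW
  have hd : DifferentiableAt ℝ W (x, t) :=
    (hV.fderiv_right (m := 1) le_rfl).differentiableAt one_ne_zero
  have hev := eventually_differentiableAt hV (by norm_num)
  have hW1 : ∀ v : Plane × ℝ, DifferentiableAt ℝ (fun z : Plane × ℝ => W (z.1, z.2) v) (x, t) :=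
    fun v => hd.clm_apply (differentiableAt_const v)
  have hW2 : ∀ v w : Plane × ℝ, fderiv ℝ (fun z : Plane × ℝ => W (z.1, z.2) v) (x, t) w =
      fderiv ℝ W (x, t) w v := fun v w => by
    have : fderiv ℝ (fun z : Plane × ℝ => W z v) (x, t) w = fderiv ℝ W (x, t) w v := by
      rw [fderiv_clm_apply hd (differentiableAt_const v)]
      simp
    exact this
  have h1 : (fun y => deriv (V y) t) =ᶠ[𝓝 x] fun y => W (y, t) (0, 1) := by
    have hc : ContinuousAt (fun y : Plane => (y, t)) x := by fun_prop
    filter_upwards [hc.eventually hev] with y hy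
    exact (hasDerivAt_slice hy).deriv
  have h2 : (fun s => pd i (fun y => V y s) x) =ᶠ[𝓝 t]
      fun s => W (x, s) (EuclideanSpace.single i 1, 0) := by
    have hc : ContinuousAt (fun s : ℝ => (x, s)) t := by fun_prop
    filter_upwards [hc.eventually hev] with s hs
    exact pd_slice hs i
  have h3 := (hasDerivAt_slice (V := fun y s => W (y, s) (EuclideanSpace.single i 1, 0))
    (hW1 _)).congr_of_eventuallyEq h2
  have h4 := pd_slice (V := fun y s => W (y, s) (0, 1)) (hW1 _) i
  rw [pd_congr h1, h4, hW2]
  rw [hW2] at h3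
  rwa [(hV.isSymmSndFDerivAt (by simp)).eq]

end SpaceTime

/-! ### The flow in a coordinate system -/

/-- The energy density in coordinates. -/
def energyC (G : Plane → Matrix (Fin 2) (Fin 2) ℝ) (ε : ℝ) (U : Fin 2 → Plane → ℝ → ℝ)
    (x : Plane) (s : ℝ) : ℝ :=
  (∑ k, gradInner G (fun y => U k y s) (fun y => U k y s) x) / 2
    + (1 - ∑ k, U k x s ^ 2) ^ 2 / (4 * ε ^ 2)

namespace IsMetricOn

variable {G : Plane → Matrix (Fin 2) (Fin 2) ℝ} {Ω : Set Plane} {x : Plane} {t ε : ℝ}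
  {U : Fin 2 → Plane → ℝ → ℝ}

theorem contDiffAt_energyC (hG : IsMetricOn G Ω) (hx : x ∈ Ω)
    (hU : ∀ k, ContDiffAt ℝ 3 (fun z : Plane × ℝ => U k z.1 z.2) (x, t)) :
    ContDiffAt ℝ 2 (fun z : Plane × ℝ => energyC G ε U z.1 z.2) (x, t) := by
  refine ContDiffAt.add ?_ ?_
  · refine ContDiffAt.div_const (ContDiffAt.sum fun k _ => ContDiffAt.sum fun i _ =>
      ContDiffAt.sum fun j _ => ?_) _
    have hH : ContDiffAt ℝ 2 (fun z : Plane × ℝ => (G z.1)⁻¹ i j) (x, t) :=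
      ContDiffAt.comp (x, t) (f := Prod.fst) (g := fun y => (G y)⁻¹ i j)
        ((hG.contDiffAt_inv hx i j).of_le two_le_infty) contDiffAt_fst
    exact (hH.mul (contDiffAt_pd_slice (hU k) le_rfl i)).mul (contDiffAt_pd_slice (hU k) le_rfl j)
  · refine ContDiffAt.div_const ((contDiffAt_const.sub (ContDiffAt.sum fun k _ => ?_)).pow 2) _
    exact ((hU k).of_le (by norm_num)).pow 2

theorem hasDerivAt_gradInner (hG : IsMetricOn G Ω) (hx : x ∈ Ω) {V : Plane → ℝ → ℝ}
    (hV : ContDiffAt ℝ 2 (fun z : Plane × ℝ => V z.1 z.2) (x, t)) :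
    HasDerivAt (fun s => gradInner G (fun y => V y s) (fun y => V y s) x)
      (2 * gradInner G (fun y => V y t) (fun y => deriv (V y) t) x) t := by
  have hp := hasDerivAt_pd_slice hV
  have H := HasDerivAt.fun_sum (u := Finset.univ) fun i _ =>
    HasDerivAt.fun_sum (u := Finset.univ) fun j _ =>
    (((hp i).const_mul ((G x)⁻¹ i j)).mul (hp j))
  refine H.congr_deriv ?_
  simp only [gradInner, Fin.sum_univ_two, hG.inv_symm hx 1 0]
  ring

theorem _root_.GLSurface.gradInner_add_mul {f a w v : Plane → ℝ} (c : ℝ)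
    (ha : DifferentiableAt ℝ a x) (hw : DifferentiableAt ℝ w x) (hv : DifferentiableAt ℝ v x) :
    gradInner G f (fun y => a y + c * (w y * v y)) x = gradInner G f a x
      + c * (w x * gradInner G f v x + v x * gradInner G f w x) := by
  have h := fun i => ((ha.hasPD i).add (((hw.hasPD i).mul (hv.hasPD i)).const_mul c)).2
  simp only [gradInner, h, Fin.sum_univ_two]
  ring

theorem _root_.GLSurface.innerC_sum_smul_gradC (c : Fin 2 → ℝ) (f : Fin 2 → Plane → ℝ) :
    innerC G x (∑ k, c k • gradC G (f k) x) (∑ k, c k • gradC G (f k) x) =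
      ∑ k, ∑ l, c k * c l * innerC G x (gradC G (f k) x) (gradC G (f l) x) := by
  simp only [innerC, Fin.sum_univ_two, Pi.add_apply, Pi.smul_apply, smul_eq_mul]
  ring

/-- The evolution of the energy density, in coordinates. The equation is needed near `x`, because
its gradient enters. -/
theorem energyC_evolution (hG : IsMetricOn G Ω) (hx : x ∈ Ω)
    (hU : ∀ k, ContDiffAt ℝ 3 (fun z : Plane × ℝ => U k z.1 z.2) (x, t))
    (heq : ∀ k, ∀ᶠ y in 𝓝 x, deriv (U k y) t = laplacianC G (fun y => U k y t) y
      + 1 / ε ^ 2 * ((1 - ∑ k, U k y t ^ 2) * U k y t)) :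
    deriv (energyC G ε U x) t - laplacianC G (fun y => energyC G ε U y t) x =
      2 / ε ^ 2 * (1 - ∑ k, U k x t ^ 2)
          * ∑ k, innerC G x (gradC G (fun y => U k y t) x) (gradC G (fun y => U k y t) x)
        - ∑ k, hessNormSqC G (fun y => U k y t) x
        - 4 / ε ^ 2 * innerC G x (∑ k, U k x t • gradC G (fun y => U k y t) x)
            (∑ k, U k x t • gradC G (fun y => U k y t) x)
        - 1 / ε ^ 4 * (1 - ∑ k, U k x t ^ 2) ^ 2 * ∑ k, U k x t ^ 2
        - (∑ k, innerC G x (gradC G (fun y => U k y t) x) (gradC G (fun y => U k y t) x))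
            * gaussC G x := by
  have hU2 := fun k => (hU k).of_le (m := 2) (by norm_num)
  have hd : ∀ k, HasDerivAt (U k x) (deriv (U k x) t) t := fun k =>
    (hasDerivAt_slice ((hU2 k).differentiableAt two_ne_zero)).differentiableAt.hasDerivAt
  set f : Fin 2 → Plane → ℝ := fun k y => U k y t with hf
  set w : Plane → ℝ := fun y => 1 - ∑ k, f k y ^ 2 with hw
  have hf3 : ∀ k, ContDiffAt ℝ 3 (f k) x := fun k => contDiffAt_slice (hU k)
  have hf2 : ∀ k, ContDiffAt ℝ 2 (f k) x := fun k => contDiffAt_slice (hU2 k)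
  have hfd : ∀ k, DifferentiableAt ℝ (f k) x := fun k => (hf2 k).differentiableAt two_ne_zero
  have hw2 : ContDiffAt ℝ 2 w x := contDiffAt_const.sub (ContDiffAt.sum fun k _ => (hf2 k).pow 2)
  have hLd : ∀ k, DifferentiableAt ℝ (laplacianC G (f k)) x := fun k => by
    have : ContDiffAt ℝ 1 (fun y => ∑ i, ∑ l, (G y)⁻¹ i l * covHess G (f k) i l y) x :=
      ContDiffAt.sum fun i _ => ContDiffAt.sum fun l _ =>
        ((hG.contDiffAt_inv hx i l).of_le (by simp)).mul
          (hG.contDiffAt_covHess hx (hf3 k) le_rfl (by simp) i l)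
    refine (this.differentiableAt one_ne_zero).congr_of_eventuallyEq ?_
    filter_upwards [hG.mem_nhds hx, (hf2 k).eventually (by simp)] with y hy hfy
    exact hG.laplacianC_eq hy hfy
  have hpw : ∀ i, pd i w x = -∑ k, 2 * f k x * pd i (f k) x := fun i => by
    have h : HasPD i (fun y => 1 - ∑ k, f k y * f k y) x _ :=
      (hasPD_const 1).sub (HasPD.sum fun k => ((hfd k).hasPD i).mul ((hfd k).hasPD i))
    simp only [hw, sq]
    rw [h.2]
    simp only [Fin.sum_univ_two]
    ring
  have hgw : ∀ a, gradInner G a w x = -∑ k, 2 * f k x * gradInner G a (f k) x := fun a => by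
    simp only [gradInner, hpw, Fin.sum_univ_two]
    ring
  have hgcomm : gradInner G (f 1) (f 0) x = gradInner G (f 0) (f 1) x := by
    simp only [gradInner, Fin.sum_univ_two, hG.inv_symm hx 1 0]
    ring
  have hgww : gradInner G w w x = 4 * ∑ k, ∑ l, f k x * f l x * gradInner G (f k) (f l) x := by
    simp only [gradInner, hpw, Fin.sum_univ_two]
    ring
  have hLw : laplacianC G w x = -∑ k, 2 * (gradInner G (f k) (f k) x
      + f k x * laplacianC G (f k) x) := by
    have e : w = fun y => 1 + -1 * (f 0 y * f 0 y + f 1 y * f 1 y) := by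
      funext y
      simp only [hw, Fin.sum_univ_two]
      ring
    have hm := fun k => (hf2 k).mul (hf2 k)
    rw [e, hG.laplacianC_add hx contDiffAt_const (contDiffAt_const.mul ((hm 0).add (hm 1))),
      hG.laplacianC_const_mul hx _ ((hm 0).add (hm 1)), hG.laplacianC_add hx (hm 0) (hm 1),
      hG.laplacianC_const hx, hG.laplacianC_mul hx (hf2 0) (hf2 0),
      hG.laplacianC_mul hx (hf2 1) (hf2 1), Fin.sum_univ_two]
    ring
  -- the Laplacian of the energy density
  have hLe : laplacianC G (fun y => energyC G ε U y t) x =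
      1 / 2 * ∑ k, laplacianC G (gradInner G (f k) (f k)) x
        + 1 / (4 * ε ^ 2) * (2 * w x * laplacianC G w x + 2 * gradInner G w w x) := by
    have e : (fun y => energyC G ε U y t) = fun y =>
        1 / 2 * (gradInner G (f 0) (f 0) y + gradInner G (f 1) (f 1) y)
          + 1 / (4 * ε ^ 2) * (w y * w y) := by
      funext y
      simp only [energyC, hw, hf, Fin.sum_univ_two]
      ring
    have hg := fun k => hG.contDiffAt_gradInner hx (m := 2) (hf3 k) (hf3 k) le_rfl two_le_infty
    rw [e, hG.laplacianC_add hx (contDiffAt_const.mul ((hg 0).add (hg 1)))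
      (contDiffAt_const.mul (hw2.mul hw2)), hG.laplacianC_const_mul hx _ ((hg 0).add (hg 1)),
      hG.laplacianC_const_mul hx _ (hw2.mul hw2), hG.laplacianC_add hx (hg 0) (hg 1),
      hG.laplacianC_mul hx hw2 hw2, Fin.sum_univ_two]
    ring
  -- the time derivative of the energy density
  have hTe : deriv (energyC G ε U x) t =
      ∑ k, gradInner G (f k) (fun y => deriv (U k y) t) x
        - 1 / ε ^ 2 * (w x * ∑ k, f k x * deriv (U k x) t) := by
    have h1 := (HasDerivAt.fun_sum (u := Finset.univ) fun k _ =>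
      hG.hasDerivAt_gradInner hx (hU2 k)).div_const 2
    have h2 := (((HasDerivAt.fun_sum (u := Finset.univ) fun k _ =>
      (hd k).fun_pow 2).const_sub 1).fun_pow 2).div_const (4 * ε ^ 2)
    have h3 : HasDerivAt (energyC G ε U x) _ t := h1.add h2
    rw [h3.deriv]
    simp only [hw, hf, Fin.sum_univ_two]
    field_simp
    ring
  have hgd : ∀ k, gradInner G (f k) (fun y => deriv (U k y) t) x =
      gradInner G (f k) (laplacianC G (f k)) x + 1 / ε ^ 2 *
        (w x * gradInner G (f k) (f k) x + f k x * gradInner G (f k) w x) := fun k => by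
    rw [← gradInner_add_mul _ (hLd k) (hw2.differentiableAt two_ne_zero) (hfd k)]
    simp only [gradInner, pd_congr (heq k)]
    rfl
  have hdx : ∀ k, deriv (U k x) t = laplacianC G (f k) x + 1 / ε ^ 2 * (w x * f k x) := fun k =>
    (heq k).self_of_nhds
  have hwx : ∑ k, U k x t ^ 2 = 1 - w x := by simp only [hw, hf]; ring
  have e2 : 2 / ε ^ 2 = 2 * (1 / ε ^ 2) := by ring
  have e4 : 4 / ε ^ 2 = 4 * (1 / ε ^ 2) := by ring
  have e4' : 1 / (4 * ε ^ 2) = 1 / 4 * (1 / ε ^ 2) := by ring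
  have e1 : 1 / ε ^ 4 = (1 / ε ^ 2) ^ 2 := by ring
  rw [hLe, hTe, innerC_sum_smul_gradC, e2, e4, e4', e1]
  have hUf : ∀ k, U k x t = f k x := fun k => rfl
  have hfeta : ∀ k, (fun y => U k y t) = f k := fun k => rfl
  simp only [hG.innerC_gradC hx, hgd, hdx, hgww, hLw, hgw, hwx, hfeta,
    fun k => hG.laplacianC_gradInner hx (hf3 k)]
  simp only [hUf, Fin.sum_univ_two, hgcomm] at hwx ⊢
  linear_combination -(1 / ε ^ 2) ^ 2 * w x ^ 2 * hwx

end IsMetricOn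


/-! ### The metric in a chart and under changes of charts -/

section Charts

variable {M : Type*} [TopologicalSpace M] [ChartedSpace (EuclideanSpace ℝ (Fin 2)) M]

/-- The change of coordinates from the chart at `q` to the chart at `p`. -/
def transition (q p : M) (y : Plane) : Plane :=
  extChartAt (𝓡 2) p ((extChartAt (𝓡 2) q).symm y)

/-- The domain of the change of coordinates from the chart at `q` to the chart at `p`. -/
def transitionDomain (q p : M) : Set Plane :=
  (extChartAt (𝓡 2) q).target ∩ (extChartAt (𝓡 2) q).symm ⁻¹' (extChartAt (𝓡 2) p).source

theorem isOpen_transitionDomain (q p : M) : IsOpen (transitionDomain q p) :=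
  (continuousOn_extChartAt_symm q).isOpen_inter_preimage (isOpen_extChartAt_target q)
    (isOpen_extChartAt_source p)

theorem symm_transition (q p : M) {y : Plane} (hy : y ∈ transitionDomain q p) :
    (extChartAt (𝓡 2) p).symm (transition q p y) = (extChartAt (𝓡 2) q).symm y :=
  (extChartAt (𝓡 2) p).left_inv hy.2

variable [IsManifold (𝓡 2) ∞ M]

/-- The metric as a field of bilinear forms on the model space, which all tangent spaces are copies
of. This removes the dependence of the type on the base point. -/
def bilinAt (g : SurfaceMetric M) (m : M) : Plane →L[ℝ] Plane →L[ℝ] ℝ := g.inner m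

/-- The derivative of the inverse of the chart at `p`, as an endomorphism of the model space. -/
def chartDeriv (p : M) (x : Plane) : Plane →L[ℝ] Plane :=
  mfderiv 𝓘(ℝ, Plane) (𝓡 2) (extChartAt (𝓡 2) p).symm x

theorem metricMatrix_apply (g : SurfaceMetric M) (p : M) (x : Plane) (i j : Fin 2) :
    metricMatrix g p x i j = bilinAt g ((extChartAt (𝓡 2) p).symm x)
      (chartDeriv p x (EuclideanSpace.single i 1)) (chartDeriv p x (EuclideanSpace.single j 1)) :=
  rfl

theorem bilinAt_chartDeriv (g : SurfaceMetric M) (p : M) (x v w : Plane) :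
    bilinAt g ((extChartAt (𝓡 2) p).symm x) (chartDeriv p x v) (chartDeriv p x w) =
      ∑ i, ∑ j, metricMatrix g p x i j * v i * w j := by
  conv_lhs => rw [eq_sum_smul_single v, eq_sum_smul_single w]
  simp only [metricMatrix_apply, Fin.sum_univ_two, map_add, map_smul, add_apply, smul_apply,
    smul_eq_mul]
  ring

theorem contMDiffAt_symm (p : M) {x : Plane} (hx : x ∈ (extChartAt (𝓡 2) p).target) :
    ContMDiffAt 𝓘(ℝ, Plane) (𝓡 2) ∞ (extChartAt (𝓡 2) p).symm x :=
  (contMDiffOn_extChartAt_symm p).contMDiffAt ((isOpen_extChartAt_target p).mem_nhds hx)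

theorem mdifferentiableAt_symm (p : M) {x : Plane} (hx : x ∈ (extChartAt (𝓡 2) p).target) :
    MDifferentiableAt 𝓘(ℝ, Plane) (𝓡 2) (extChartAt (𝓡 2) p).symm x :=
  (contMDiffAt_symm p hx).mdifferentiableAt (by simp)

theorem chartDeriv_injective (p : M) {x : Plane} (hx : x ∈ (extChartAt (𝓡 2) p).target) :
    Function.Injective (chartDeriv p x) := by
  have h := isInvertible_mfderivWithin_extChartAt_symm (I := 𝓡 2) hx
  have hr : Set.range (𝓡 2) = Set.univ := by simp
  rw [hr, mfderivWithin_univ] at h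
  exact h.injective

/-- The matrix of the metric is smooth on the whole chart, and nondegenerate because the metric is
positive definite and the derivative of the inverse chart is injective. -/
theorem isMetricOn_metricMatrix (g : SurfaceMetric M) (p : M) :
    IsMetricOn (metricMatrix g p) (extChartAt (𝓡 2) p).target where
  isOpen := isOpen_extChartAt_target p
  smooth i j := by
    have ho : IsOpen (extChartAt (𝓡 2) p).target := isOpen_extChartAt_target p
    -- the coordinate vector fields are smooth, being images of constant vector fields
    have hv : ∀ e : Plane, ContMDiffOn 𝓘(ℝ, Plane) (𝓡 2).tangent ∞
        (fun x => (⟨(extChartAt (𝓡 2) p).symm x,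
          mfderiv 𝓘(ℝ, Plane) (𝓡 2) (extChartAt (𝓡 2) p).symm x e⟩ : TangentBundle (𝓡 2) M))
        (extChartAt (𝓡 2) p).target := by
      intro e
      have h1 := (contMDiffOn_extChartAt_symm (I := 𝓡 2) (n := ∞) p).contMDiffOn_tangentMapWithin
        (m := ∞) (by simp) ho.uniqueMDiffOn
      have h2 : ContMDiffOn 𝓘(ℝ, Plane) 𝓘(ℝ, Plane).tangent ∞
          (fun x : Plane => (⟨x, e⟩ : TangentBundle 𝓘(ℝ, Plane) Plane))
          (extChartAt (𝓡 2) p).target :=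
        contMDiffOn_vectorSpace_iff_contDiffOn.2 (contDiffOn_const (c := e))
      refine (h1.comp h2 (fun x hx => hx)).congr fun x hx => ?_
      simp only [Function.comp, tangentMapWithin, mfderivWithin_of_isOpen ho hx]
    intro x hx
    have hb := (contMDiffAt_symm p hx).contMDiffWithinAt (s := (extChartAt (𝓡 2) p).target)
    have : ContMDiffWithinAt 𝓘(ℝ, Plane) ((𝓡 2).prod 𝓘(ℝ)) ∞
        (fun m ↦ Bundle.TotalSpace.mk' ℝ (E := Bundle.Trivial M ℝ) ((extChartAt (𝓡 2) p).symm m)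
          (metricMatrix g p m i j)) (extChartAt (𝓡 2) p).target x := by
      apply ContMDiffWithinAt.clm_bundle_apply₂ (F₁ := Plane) (F₂ := Plane)
      · exact ContMDiffAt.comp_contMDiffWithinAt x g.contMDiff.contMDiffAt hb
      · exact hv _ x hx
      · exact hv _ x hx
    simp only [Bundle.contMDiffWithinAt_totalSpace] at this
    exact this.2.contDiffWithinAt
  symm y _ i j := g.symm _ _ _
  det_ne y hy h0 := by
    obtain ⟨v, hv, hGv⟩ := Matrix.exists_mulVec_eq_zero_iff.mpr h0
    have hne : WithLp.toLp 2 v ≠ (0 : Plane) := fun h => hv (congrArg WithLp.ofLp h)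
    have hD : chartDeriv p y (WithLp.toLp 2 v) ≠ 0 := fun h =>
      hne (chartDeriv_injective p hy (h.trans (map_zero _).symm))
    have hpos : 0 < bilinAt g _ _ _ := g.pos ((extChartAt (𝓡 2) p).symm y) _ hD
    rw [bilinAt_chartDeriv] at hpos
    have h1 := congrFun hGv 0
    have h2 := congrFun hGv 1
    simp only [Matrix.mulVec, dotProduct, Fin.sum_univ_two, Pi.zero_apply] at h1 h2 hpos
    refine hpos.ne' ?_
    linear_combination v 0 * h1 + v 1 * h2

theorem IsMetricOn.mono {G : Plane → Matrix (Fin 2) (Fin 2) ℝ} {Ω Ω' : Set Plane}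
    (hG : IsMetricOn G Ω) (h : Ω' ⊆ Ω) (ho : IsOpen Ω') : IsMetricOn G Ω' :=
  ⟨ho, fun i j => (hG.smooth i j).mono h, fun y hy => hG.symm y (h hy),
    fun y hy => hG.det_ne y (h hy)⟩

theorem contDiffAt_transition (q p : M) {y : Plane} (hy : y ∈ transitionDomain q p) :
    ContDiffAt ℝ ∞ (transition q p) y := by
  rw [← contMDiffAt_iff_contDiffAt]
  have h2 : (extChartAt (𝓡 2) q).symm y ∈ (extChartAt (𝓡 2) p).source := hy.2
  rw [extChartAt_source] at h2
  exact (contMDiffAt_extChartAt' h2).comp y (contMDiffAt_symm q hy.1)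

/-- Changes of charts pull back the matrix of the metric, by the chain rule for the inverse
charts. -/
theorem isPullbackOn_transition (g : SurfaceMetric M) (q p : M) :
    IsPullbackOn (transition q p) (metricMatrix g q) (metricMatrix g p) (transitionDomain q p)
      (extChartAt (𝓡 2) p).target where
  source := (isMetricOn_metricMatrix g q).mono Set.inter_subset_left (isOpen_transitionDomain q p)
  target := isMetricOn_metricMatrix g p
  mapsTo y hy := (extChartAt (𝓡 2) p).map_source hy.2
  contDiffAt y hy := contDiffAt_transition q p hy
  pullback y hy i j := by
    have hφ := (contDiffAt_transition q p hy).differentiableAt (by simp)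
    have hty : transition q p y ∈ (extChartAt (𝓡 2) p).target :=
      (extChartAt (𝓡 2) p).map_source hy.2
    have hD : chartDeriv q y =
        (chartDeriv p (transition q p y)).comp (fderiv ℝ (transition q p) y) := by
      have hev : (extChartAt (𝓡 2) q).symm =ᶠ[𝓝 y]
          (extChartAt (𝓡 2) p).symm ∘ transition q p := by
        filter_upwards [(isOpen_transitionDomain q p).mem_nhds hy] with z hz
        exact (symm_transition q p hz).symm
      have h1 : chartDeriv q y = mfderiv 𝓘(ℝ, Plane) (𝓡 2)
          ((extChartAt (𝓡 2) p).symm ∘ transition q p) y := hev.mfderiv_eq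
      rw [h1, mfderiv_comp y (mdifferentiableAt_symm p hty) hφ.mdifferentiableAt,
        mfderiv_eq_fderiv]
      rfl
    simp only [pd_apply hφ]
    rw [metricMatrix_apply, hD, ← symm_transition q p hy]
    exact bilinAt_chartDeriv g p _ _ _

end Charts


/-! ### The flow on the surface -/

section Flow

variable {M : Type*} [TopologicalSpace M] [ChartedSpace (EuclideanSpace ℝ (Fin 2)) M]

theorem extChartAt_mem_transitionDomain {q p : M} (hq : q ∈ (extChartAt (𝓡 2) p).source) :
    extChartAt (𝓡 2) q q ∈ transitionDomain q p :=
  ⟨mem_extChartAt_target q, by rwa [Set.mem_preimage, extChartAt_to_inv]⟩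

theorem transition_extChartAt (q p : M) :
    transition q p (extChartAt (𝓡 2) q q) = extChartAt (𝓡 2) p q := by
  rw [transition, extChartAt_to_inv]

theorem coordExpr_eventuallyEq {q p : M} (hq : q ∈ (extChartAt (𝓡 2) p).source) (f : M → ℝ) :
    coordExpr q f =ᶠ[𝓝 (extChartAt (𝓡 2) q q)] fun y => coordExpr p f (transition q p y) := by
  filter_upwards [(isOpen_transitionDomain q p).mem_nhds (extChartAt_mem_transitionDomain hq)]
    with y hy
  rw [coordExpr, coordExpr, symm_transition q p hy]

variable [IsManifold (𝓡 2) ∞ M]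

/-- `|∇f|²` at `q`, computed in the chart at `p`. -/
theorem normSq_grad_eq (g : SurfaceMetric M) {q p : M} (hq : q ∈ (extChartAt (𝓡 2) p).source)
    {f : M → ℝ} (hf : DifferentiableAt ℝ (coordExpr p f) (extChartAt (𝓡 2) p q)) :
    normSq g q (grad g f q) =
      gradInner (metricMatrix g p) (coordExpr p f) (coordExpr p f) (extChartAt (𝓡 2) p q) := by
  rw [normSq, grad, (isMetricOn_metricMatrix g q).innerC_gradC (mem_extChartAt_target q)]
  rw [← transition_extChartAt q p] at hf ⊢
  rw [← (isPullbackOn_transition g q p).gradInner_comp (extChartAt_mem_transitionDomain hq) hf hf]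
  simp only [gradInner, pd_congr (coordExpr_eventuallyEq hq f)]

/-- The Laplacian at `q`, computed in the chart at `p`. -/
theorem laplaceBeltrami_eq (g : SurfaceMetric M) {q p : M}
    (hq : q ∈ (extChartAt (𝓡 2) p).source) {f : M → ℝ}
    (hf : ContDiffAt ℝ 2 (coordExpr p f) (extChartAt (𝓡 2) p q)) :
    laplaceBeltrami g f q =
      laplacianC (metricMatrix g p) (coordExpr p f) (extChartAt (𝓡 2) p q) := by
  rw [laplaceBeltrami, laplacianC_congr (coordExpr_eventuallyEq hq f)]
  rw [← transition_extChartAt q p] at hf ⊢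
  exact (isPullbackOn_transition g q p).laplacianC_comp (extChartAt_mem_transitionDomain hq) hf

theorem norm_sq_eq_sum (v : Plane) : ‖v‖ ^ 2 = ∑ k, v k ^ 2 := by
  simp [EuclideanSpace.norm_sq_eq]

theorem three_le_infty : (3 : WithTop ℕ∞) ≤ ∞ :=
  WithTop.coe_le_coe.mpr (le_top : (3 : ℕ∞) ≤ ⊤)

/-- The components of a time dependent map in the chart at `p`. -/
def coordFlow (p : M) (u : M → ℝ → Plane) (k : Fin 2) (x : Plane) (s : ℝ) : ℝ :=
  u ((extChartAt (𝓡 2) p).symm x) s k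

namespace IsHeatFlow

variable {g : SurfaceMetric M} {ε : ℝ} {u : M → ℝ → Plane}

theorem contDiffAt_coordFlow (hu : IsHeatFlow g ε u) (p : M) {x : Plane}
    (hx : x ∈ (extChartAt (𝓡 2) p).target) {t : ℝ} (ht : 0 < t) (k : Fin 2) :
    ContDiffAt ℝ 3 (fun z : Plane × ℝ => coordFlow p u k z.1 z.2) (x, t) := by
  have ho : IsOpen {q : M × ℝ | 0 < q.2} := isOpen_lt continuous_const continuous_snd
  have h1 : ContMDiffAt ((𝓡 2).prod 𝓘(ℝ, ℝ)) 𝓘(ℝ, Plane) 3 (fun q : M × ℝ => u q.1 q.2)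
      ((extChartAt (𝓡 2) p).symm x, t) :=
    hu.regular.contMDiffAt (ho.mem_nhds ht)
  have h2 : ContMDiffAt (𝓘(ℝ, Plane).prod 𝓘(ℝ, ℝ)) ((𝓡 2).prod 𝓘(ℝ, ℝ)) 3
      (fun z : Plane × ℝ => ((extChartAt (𝓡 2) p).symm z.1, z.2)) (x, t) := by
    refine ContMDiffAt.prodMk ?_ contMDiffAt_snd
    exact ContMDiffAt.comp (x, t) (f := Prod.fst)
      ((contMDiffAt_symm p hx).of_le three_le_infty) contMDiffAt_fst
  have h3 := ContMDiffAt.comp (x, t) h1 h2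
  rw [← modelWithCornersSelf_prod, chartedSpaceSelf_prod, contMDiffAt_iff_contDiffAt] at h3
  exact contDiffAt_euclidean.mp h3 k

theorem contDiffAt_coordExpr (hu : IsHeatFlow g ε u) (p : M) {x : Plane}
    (hx : x ∈ (extChartAt (𝓡 2) p).target) {t : ℝ} (ht : 0 < t) (k : Fin 2) :
    ContDiffAt ℝ 3 (coordExpr p fun q => u q t k) x :=
  contDiffAt_slice (hu.contDiffAt_coordFlow p hx ht k)

/-- The energy density on the domain of the chart at `p`, computed in that chart. -/
theorem energyDensity_eq (hu : IsHeatFlow g ε u) {q p : M}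
    (hq : q ∈ (extChartAt (𝓡 2) p).source) {t : ℝ} (ht : 0 < t) :
    energyDensity g ε (fun y => u y t) q =
      energyC (metricMatrix g p) ε (coordFlow p u) (extChartAt (𝓡 2) p q) t := by
  have hx := (extChartAt (𝓡 2) p).map_source hq
  have h : ∀ k, normSq g q (grad g (fun y => u y t k) q) = _ := fun k =>
    normSq_grad_eq g hq ((hu.contDiffAt_coordExpr p hx ht k).differentiableAt three_ne_zero)
  simp only [energyDensity, energyC, gradNormSq, h, norm_sq_eq_sum, coordFlow,
    (extChartAt (𝓡 2) p).left_inv hq]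
  rfl

/-- The flow equation on the whole chart at `p`, written in that chart. -/
theorem deriv_coordFlow (hu : IsHeatFlow g ε u) (p : M) {x : Plane}
    (hx : x ∈ (extChartAt (𝓡 2) p).target) {t : ℝ} (ht : 0 < t) (k : Fin 2) :
    deriv (coordFlow p u k x) t = laplacianC (metricMatrix g p) (fun y => coordFlow p u k y t) x
      + 1 / ε ^ 2 * ((1 - ∑ k, coordFlow p u k x t ^ 2) * coordFlow p u k x t) := by
  set q := (extChartAt (𝓡 2) p).symm x with hqdef
  have hq : q ∈ (extChartAt (𝓡 2) p).source := (extChartAt (𝓡 2) p).map_target hx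
  have hqx : extChartAt (𝓡 2) p q = x := (extChartAt (𝓡 2) p).right_inv hx
  have hd : ∀ k, DifferentiableAt ℝ (fun s => u q s k) t := fun k =>
    (hasDerivAt_slice ((hu.contDiffAt_coordFlow p hx ht k).differentiableAt
      three_ne_zero)).differentiableAt
  have hdu : DifferentiableAt ℝ (fun s => u q s) t := differentiableAt_euclidean.mpr hd
  have hk : deriv (fun s => u q s k) t = (deriv (fun s => u q s) t) k :=
    (((EuclideanSpace.proj (𝕜 := ℝ) k : Plane →L[ℝ] ℝ).hasFDerivAt).comp_hasDerivAt t
      hdu.hasDerivAt).deriv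
  have hL := laplaceBeltrami_eq g hq (f := fun y => u y t k) (by
    rw [hqx]
    exact (hu.contDiffAt_coordExpr p hx ht k).of_le (by norm_num))
  have he := congrArg (fun v : Plane => v k) (hu.equation q t ht)
  simp only [PiLp.sub_apply, PiLp.smul_apply, smul_eq_mul, laplaceBeltramiVec, hL, hqx,
    norm_sq_eq_sum, ← hk] at he
  change deriv (fun s => u q s k) t = laplacianC (metricMatrix g p) (coordExpr p fun y => u y t k) x
    + 1 / ε ^ 2 * ((1 - ∑ k, u q t k ^ 2) * u q t k)
  linear_combination he

theorem contMDiffOn_energyDensity (hu : IsHeatFlow g ε u) :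
    ContMDiffOn ((𝓡 2).prod 𝓘(ℝ, ℝ)) 𝓘(ℝ, ℝ) 2
      (fun q : M × ℝ => energyDensity g ε (fun y => u y q.2) q.1) {q : M × ℝ | 0 < q.2} := by
  rintro ⟨p, t⟩ ht
  have ht : 0 < t := ht
  refine ContMDiffAt.contMDiffWithinAt ?_
  have hE := (isMetricOn_metricMatrix g p).contDiffAt_energyC (ε := ε) (mem_extChartAt_target p)
    fun k => hu.contDiffAt_coordFlow p (mem_extChartAt_target p) ht k
  have h1 := hE.contMDiffAt
  rw [modelWithCornersSelf_prod, ← chartedSpaceSelf_prod] at h1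
  have h2 : ContMDiffAt ((𝓡 2).prod 𝓘(ℝ, ℝ)) (𝓘(ℝ, Plane).prod 𝓘(ℝ, ℝ)) 2
      (fun z : M × ℝ => (extChartAt (𝓡 2) p z.1, z.2)) (p, t) := by
    refine ContMDiffAt.prodMk ?_ contMDiffAt_snd
    exact ContMDiffAt.comp (p, t) (f := Prod.fst)
      ((contMDiffAt_extChartAt (n := ∞)).of_le two_le_infty) contMDiffAt_fst
  refine (ContMDiffAt.comp (p, t) h1 h2).congr_of_eventuallyEq ?_
  have hs : (extChartAt (𝓡 2) p).source ×ˢ Set.Ioi (0 : ℝ) ∈ 𝓝 (p, t) :=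
    prod_mem_nhds (extChartAt_source_mem_nhds p) (Ioi_mem_nhds ht)
  filter_upwards [hs] with z hz
  exact hu.energyDensity_eq hz.1 hz.2

end IsHeatFlow

end Flow

end GLSurface

end

theorem mainTheorem10 {M : Type*} [TopologicalSpace M]
    [ChartedSpace (EuclideanSpace ℝ (Fin 2)) M] [IsManifold (𝓡 2) ∞ M]
    (g : GLSurface.SurfaceMetric M) (ε : ℝ) (hε : 0 < ε) (u : M → ℝ → GLSurface.Plane)
    (hu : GLSurface.IsHeatFlow g ε u) :
    ContMDiffOn ((𝓡 2).prod 𝓘(ℝ, ℝ)) 𝓘(ℝ, ℝ) 2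
      (fun q : M × ℝ => GLSurface.energyDensity g ε (fun y => u y q.2) q.1)
      {q : M × ℝ | 0 < q.2} ∧
    ∀ (p : M) (t : ℝ), 0 < t →
      deriv (fun s => GLSurface.energyDensity g ε (fun y => u y s) p) t
        - GLSurface.laplaceBeltrami g
            (fun q => GLSurface.energyDensity g ε (fun y => u y t) q) p
      = 2 / ε ^ 2 * (1 - ‖u p t‖ ^ 2) * GLSurface.gradNormSq g (fun y => u y t) p
        - GLSurface.hessNormSq g (fun y => u y t) p
        - 4 / ε ^ 2 * GLSurface.normSq g p (GLSurface.dotGrad g (fun y => u y t) p)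
        - 1 / ε ^ 4 * (1 - ‖u p t‖ ^ 2) ^ 2 * ‖u p t‖ ^ 2
        - GLSurface.gradNormSq g (fun y => u y t) p * GLSurface.gaussCurvature g p := by
  refine ⟨hu.contMDiffOn_energyDensity, fun p t ht => ?_⟩
  have hx := mem_extChartAt_target (I := 𝓡 2) p
  have ho : (extChartAt (𝓡 2) p).target ∈ nhds (extChartAt (𝓡 2) p p) :=
    (isOpen_extChartAt_target p).mem_nhds hx
  have hmain := (GLSurface.isMetricOn_metricMatrix g p).energyC_evolution hx
    (fun k => hu.contDiffAt_coordFlow p hx ht k) (fun k => by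
      filter_upwards [ho] with y hy using hu.deriv_coordFlow p hy ht k)
  have hT : deriv (fun s => GLSurface.energyDensity g ε (fun y => u y s) p) t =
      deriv (GLSurface.energyC (GLSurface.metricMatrix g p) ε (GLSurface.coordFlow p u)
        (extChartAt (𝓡 2) p p)) t := by
    refine Filter.EventuallyEq.deriv_eq ?_
    filter_upwards [Ioi_mem_nhds ht] with s hs
    exact hu.energyDensity_eq (mem_extChartAt_source p) hs
  have hL : GLSurface.laplaceBeltrami g
        (fun q => GLSurface.energyDensity g ε (fun y => u y t) q) p =
      GLSurface.laplacianC (GLSurface.metricMatrix g p) (fun y => GLSurface.energyC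
        (GLSurface.metricMatrix g p) ε (GLSurface.coordFlow p u) y t)
        (extChartAt (𝓡 2) p p) := by
    refine GLSurface.laplacianC_congr ?_
    filter_upwards [ho] with y hy
    rw [GLSurface.coordExpr, hu.energyDensity_eq ((extChartAt (𝓡 2) p).map_target hy) ht,
      (extChartAt (𝓡 2) p).right_inv hy]
  have hu0 : ∀ k, GLSurface.coordFlow p u k (extChartAt (𝓡 2) p p) t = u p t k := fun k => by
    rw [GLSurface.coordFlow, extChartAt_to_inv]
  rw [hT, hL, hmain]
  simp only [hu0, GLSurface.norm_sq_eq_sum]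
  rfl
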